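/- Let $\tau,\tau_1,\tau_2,\dots\ge 0$ be i.i.d. random variables with $0<\mathbb E\tau<\infty$ and let $\xi,\xi_1,\xi_2,\dots\ge 0$ be i.i.d. random variables with finite variance, the two sequences being independent of each other. Put $T_n=\tau_1+\dots+\tau_n$, $N(t)=\max\{n\ge 0: T_n\le t\}$ and $v_c=\mathbb E\xi/\mathbb E\tau$. Let $v:\mathbb R\to[0,\infty)$ be a bounded measurable function such that for every $x\ge 0$ the equation $V(t)=x+\int_0^t v(V(s))\,ds$, $t\ge 0$, has exactly one solution. For each initial reserve $x\ge0$ let the risk reserve process $R$ satisfy, almost surely, $$R(t)=x+\int_0^t v(R(s))\,ds-\sum_{j=1}^{N(t)}\xi_j\qquad\text{for all }t\ge 0,$$ and let $\psi(x)=\mathbb P\{R(t)<0\text{ for some }t\ge 0\}$ be the probability of ruin for the initial reserve $x$. Assume that 1. $\inf_{0\le x\le x_0}\psi(x)>0$ for every $x_0\ge 0$; 2. for some $\theta\in\mathbb R$ and some decreasing function $p$ on $(1,\infty)$ that is integrable at infinity, $\bigl|v(z)-v_c-\theta/z\bigr|\le p(z)$ for all $z>1$; 3. $\theta>\dfrac{\operatorname{Var}\xi+v_c^2\operatorname{Var}\tau}{2\,\mathbb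 E\tau}$. Set $$\rho=\frac{2\theta\,\mathbb E\tau}{\operatorname{Var}\xi+v_c^2\operatorname{Var}\tau}-1 .$$ If both $\mathbb E\,\tau^2\log(1+\tau)$ and $\mathbb E\,\xi^{\rho+2}$ are finite, then there exist positive constants $c_1$ and $c_2$ such that $$\frac{c_1}{(1+x)^\rho}\le\psi(x)\le\frac{c_2}{(1+x)^\rho}\qquad\text{for all }x>0 .$$ (Condition 1 rules out $\operatorname{Var}\xi+v_c^2\operatorname{Var}\tau=0$, so $\rho$ is well defined.) -/

import Mathlib

open MeasureTheory ProbabilityTheory Filter Topology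

noncomputable section

namespace RiskModel

/-- The `n`-th claim epoch `T_n`, the sum of the first `n` inter-claim times
(`τ 0` is the waiting time for the first claim). -/
def claimEpoch {Ω : Type*} (τ : ℕ → Ω → ℝ) (n : ℕ) (ω : Ω) : ℝ :=
  ∑ i ∈ Finset.range n, τ i ω

/-- The number of claims up to time `t`: `N(t) = max {n : T_n ≤ t}`. -/
def claimCount {Ω : Type*} (τ : ℕ → Ω → ℝ) (t : ℝ) (ω : Ω) : ℕ :=
  sSup {n : ℕ | claimEpoch τ n ω ≤ t}

/-- The total amount of the claims that arrive up to time `t`. -/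
def aggregateClaims {Ω : Type*} (ξ τ : ℕ → Ω → ℝ) (ω : Ω) (t : ℝ) : ℝ :=
  ∑ i ∈ Finset.range (claimCount τ t ω), ξ i ω

/-- The path `r` on `[0, ∞)` satisfies `r(t) = x + ∫₀ᵗ v(r(s)) ds - A(t)`. -/
def IsReservePath (v : ℝ → ℝ) (x : ℝ) (A r : ℝ → ℝ) : Prop :=
  ∀ t : ℝ, 0 ≤ t →
    IntervalIntegrable (fun s => v (r s)) volume 0 t ∧
      r t = x + (∫ s in (0 : ℝ)..t, v (r s)) - A t

/-- For every initial level `x ≥ 0` the claim-free equation `V(t) = x + ∫₀ᵗ v(V(s)) ds`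
has exactly one solution on `[0, ∞)`. -/
def HasUniqueFlow (v : ℝ → ℝ) : Prop :=
  ∀ x : ℝ, 0 ≤ x →
    (∃ V : ℝ → ℝ, IsReservePath v x (fun _ => 0) V) ∧
      ∀ V W : ℝ → ℝ, IsReservePath v x (fun _ => 0) V → IsReservePath v x (fun _ => 0) W →
        ∀ t : ℝ, 0 ≤ t → V t = W t

/-- The family `R x` (with `R x t ω` the reserve at time `t` for the initial reserve `x ≥ 0`)
satisfies almost surely `R(t) = x + ∫₀ᵗ v(R(s)) ds - ∑_{j ≤ N(t)} ξ_j` for all `t ≥ 0`. -/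
def IsRiskProcess {Ω : Type*} [MeasurableSpace Ω] (μ : Measure Ω) (v : ℝ → ℝ)
    (ξ τ : ℕ → Ω → ℝ) (R : ℝ → ℝ → Ω → ℝ) : Prop :=
  ∀ x : ℝ, 0 ≤ x →
    ∀ᵐ ω ∂μ, IsReservePath v x (aggregateClaims ξ τ ω) (fun t => R x t ω)

/-- The ruin probability `ψ(x) = P(R(t) < 0 for some t ≥ 0)`, `R(0) = x`. -/
def ruinProb {Ω : Type*} [MeasurableSpace Ω] (μ : Measure Ω) (R : ℝ → ℝ → Ω → ℝ)
    (x : ℝ) : ℝ :=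
  μ.real {ω | ∃ t : ℝ, 0 ≤ t ∧ R x t ω < 0}

/-- The critical premium rate `v_c = E X / E S` (claim size `X`, inter-claim time `S`). -/
def criticalRate {Ω : Type*} [MeasurableSpace Ω] (μ : Measure Ω) (X S : Ω → ℝ) : ℝ :=
  (∫ ω, X ω ∂μ) / ∫ ω, S ω ∂μ

/-- `Var X + v_c² Var S`. -/
def limitVariance {Ω : Type*} [MeasurableSpace Ω] (μ : Measure Ω) (X S : Ω → ℝ) : ℝ :=
  variance X μ + criticalRate μ X S ^ 2 * variance S μ

/-- `ρ = 2 θ E S / (Var X + v_c² Var S) - 1`. -/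
def decayExponent {Ω : Type*} [MeasurableSpace Ω] (μ : Measure Ω) (X S : Ω → ℝ)
    (θ : ℝ) : ℝ :=
  2 * θ * (∫ ω, S ω ∂μ) / limitVariance μ X S - 1

end RiskModel

end

/-! Premiums are nonnegative, so ruin can occur only at a claim epoch. Since the claim-free equation
has unique solutions, the reserve at claim epochs is a Markov chain, `y ↦ φ y τ - ξ` with `φ` the
deterministic flow, and `ψ` is the probability that this chain becomes negative
(`ruinProb_eq_chainRuin`).

From a high level `x` a step of the chain has mean close to `θ Eτ / x` and second moment close to `σ
= Var ξ + v_c² Var τ`. To leading order its generator is that of a Bessel-type diffusion, `(θ Eτ /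
x) f' + (σ / 2) f''`. This annihilates `x ^ (-ρ)` exactly when `(ρ + 1) σ = 2 θ Eτ`, which is the
stated `ρ`.

To turn this heuristic into two-sided bounds, `-f' = x ^ (-(ρ + 1))` is multiplied by `1 + s ∫_x^∞
q` with `s = ±1`. The perturbation adds `s x ^ (-(ρ + 1)) q(x) σ / 2` to the generator. If `q` is a
large multiple of a majorant of all error terms, this term decides the sign of the drift: `s = 1`
gives a subharmonic function and `s = -1` a superharmonic one, both comparable to `x ^ (-ρ)`
(`exists_perturbation_drift`). The scheme needs the errors to have an integrable majorant. They come
from `p`, from large upward steps and from large downward steps; the moments `E τ² log(1+τ)` and `E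
ξ^(ρ+2)` make the last two integrable.

The superharmonic function dominates `ψ` by comparison (`chainRuin_le`). A multiple of `ψ` dominates
the subharmonic one by a maximum principle at infinity (`nonpos_of_subharmonic`), where condition 1
controls bounded levels (`chainRuin_bounds_of_drift`). -/

namespace RiskModel

/-! ### The deterministic flow between claims. -/

section Flow

variable {v : ℝ → ℝ} {C : ℝ}

/-- Two solutions glue at time `s`. The equation for `U` is asked only strictly before `s`, because
a reserve path jumps at a claim; the integral ignores the single instant. -/
theorem IsReservePath.concat {U V : ℝ → ℝ} {x s : ℝ} (hs : 0 ≤ s)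
    (hint : IntervalIntegrable (fun u => v (U u)) volume 0 s)
    (hU : ∀ t, 0 ≤ t → t < s → U t = x + ∫ u in (0 : ℝ)..t, v (U u))
    (hV : IsReservePath v (x + ∫ u in (0 : ℝ)..s, v (U u)) (fun _ => 0) V) :
    IsReservePath v x (fun _ => 0) (fun t => if t < s then U t else V (t - s)) := by
  have hlt : ∀ t, 0 ≤ t → t ≤ s → Set.EqOn (fun u => v (if u < s then U u else V (u - s)))
      (fun u => v (U u)) (Set.Ioo 0 t) := by
    intro t _ hts u hu
    simp [hu.2.trans_le hts]
  have hI1 : ∀ t, 0 ≤ t → t ≤ s →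
      IntervalIntegrable (fun u => v (if u < s then U u else V (u - s))) volume 0 t ∧
      ∫ u in (0 : ℝ)..t, v (if u < s then U u else V (u - s)) = ∫ u in (0 : ℝ)..t, v (U u) := by
    intro t h0 hts
    constructor
    · have h1 : IntervalIntegrable (fun u => v (U u)) volume 0 t :=
        hint.mono_set (by
          rw [Set.uIcc_of_le h0, Set.uIcc_of_le hs]; exact Set.Icc_subset_Icc_right hts)
      rw [intervalIntegrable_iff_integrableOn_Ioo_of_le h0] at h1 ⊢
      exact h1.congr_fun (hlt t h0 hts).symm measurableSet_Ioo
    · rw [intervalIntegral.integral_of_le h0, intervalIntegral.integral_of_le h0,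
        integral_Ioc_eq_integral_Ioo, integral_Ioc_eq_integral_Ioo]
      exact setIntegral_congr_fun measurableSet_Ioo (hlt t h0 hts)
  intro t ht
  by_cases hts : t < s
  · refine ⟨(hI1 t ht hts.le).1, ?_⟩
    rw [(hI1 t ht hts.le).2]
    simp [hts, hU t ht hts]
  · have hst : s ≤ t := not_lt.mp hts
    have hVt := hV (t - s) (by linarith)
    have heq : Set.EqOn (fun u => v (if u < s then U u else V (u - s)))
        (fun u => v (V (u - s))) (Set.uIcc s t) := by
      intro u hu
      rw [Set.uIcc_of_le hst] at hu
      simp [not_lt.mpr hu.1]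
    have hI2 : IntervalIntegrable (fun u => v (V (u - s))) volume s t := by
      have := hVt.1.comp_sub_right s
      simpa using this
    have hI3 : IntervalIntegrable (fun u => v (if u < s then U u else V (u - s))) volume s t :=
      hI2.congr (fun u hu => (heq (Set.uIoc_subset_uIcc hu)).symm)
    refine ⟨(hI1 s hs le_rfl).1.trans hI3, ?_⟩
    rw [← intervalIntegral.integral_add_adjacent_intervals (hI1 s hs le_rfl).1 hI3,
      (hI1 s hs le_rfl).2, intervalIntegral.integral_congr heq,
      intervalIntegral.integral_comp_sub_right (fun u => v (V u)) s]
    simp only [hts, if_false, sub_self]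
    rw [hVt.2]
    ring

/-- A jointly measurable version of the claim-free flow. -/
structure IsFlow (v : ℝ → ℝ) (φ : ℝ → ℝ → ℝ) : Prop where
  measurable : Measurable (Function.uncurry φ)
  path : ∀ x, 0 ≤ x → IsReservePath v x (fun _ => 0) (φ x)

variable {φ : ℝ → ℝ → ℝ}

theorem IsReservePath.integral_mem_Icc {r : ℝ → ℝ} (h0 : ∀ y, 0 ≤ v y) (hC : ∀ y, v y ≤ C)
    {s t : ℝ} (hst : s ≤ t) (hi : IntervalIntegrable (fun u => v (r u)) volume s t) :
    (∫ u in s..t, v (r u)) ∈ Set.Icc 0 (C * (t - s)) := by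
  constructor
  · exact intervalIntegral.integral_nonneg hst fun u _ => h0 _
  · calc (∫ u in s..t, v (r u)) ≤ ∫ _ in s..t, C :=
        intervalIntegral.integral_mono_on hst hi intervalIntegrable_const fun u _ => hC _
      _ = C * (t - s) := by simp [mul_comm]

theorem IsReservePath.sub_mem_Icc {V : ℝ → ℝ} {x : ℝ} (h0 : ∀ y, 0 ≤ v y) (hC : ∀ y, v y ≤ C)
    (hV : IsReservePath v x (fun _ => 0) V) {s t : ℝ} (hs : 0 ≤ s) (hst : s ≤ t) :
    V t - V s ∈ Set.Icc 0 (C * (t - s)) := by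
  have h1 := hV s hs
  have h2 := hV t (hs.trans hst)
  have hi : IntervalIntegrable (fun u => v (V u)) volume s t := h1.1.symm.trans h2.1
  have := IsReservePath.integral_mem_Icc h0 hC hst hi
  rw [h1.2, h2.2, ← intervalIntegral.integral_add_adjacent_intervals h1.1 hi]
  convert this using 1
  ring

theorem IsReservePath.zero_eq {V : ℝ → ℝ} {x : ℝ} (hV : IsReservePath v x (fun _ => 0) V) :
    V 0 = x := by
  have := (hV 0 le_rfl).2
  simpa using this

theorem IsReservePath.congr {V W : ℝ → ℝ} {x : ℝ} {A : ℝ → ℝ} (hV : IsReservePath v x A V)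
    (h : ∀ t, 0 ≤ t → W t = V t) : IsReservePath v x A W := by
  intro t ht
  have heq : Set.EqOn (fun u => v (W u)) (fun u => v (V u)) (Set.uIcc 0 t) := by
    intro u hu
    rw [Set.uIcc_of_le ht] at hu
    simp [h u hu.1]
  refine ⟨(hV t ht).1.congr fun u hu => (heq (Set.uIoc_subset_uIcc hu)).symm, ?_⟩
  rw [intervalIntegral.integral_congr heq, h t ht, (hV t ht).2]

theorem IsReservePath.continuous_max {V : ℝ → ℝ} {x : ℝ} (h0 : ∀ y, 0 ≤ v y)
    (hC : ∀ y, v y ≤ C) (hV : IsReservePath v x (fun _ => 0) V) :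
    Continuous fun t => V (max t 0) := by
  have hC0 : 0 ≤ C := (h0 0).trans (hC 0)
  have key : ∀ s t : ℝ, s ≤ t → |V (max t 0) - V (max s 0)| ≤ C * |t - s| := by
    intro s t hst
    have h := hV.sub_mem_Icc h0 hC (le_max_right s 0) (max_le_max_right 0 hst)
    rw [abs_of_nonneg h.1, abs_of_nonneg (by linarith)]
    refine h.2.trans (mul_le_mul_of_nonneg_left ?_ hC0)
    have := abs_max_sub_max_le_abs t s 0
    rw [abs_of_nonneg (sub_nonneg.2 hst)] at this
    exact (le_abs_self _).trans this
  refine (LipschitzWith.of_dist_le_mul (K := ⟨C, hC0⟩) fun s t => ?_).continuous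
  rw [Real.dist_eq, Real.dist_eq]
  rcases le_total s t with h | h
  · rw [abs_sub_comm, abs_sub_comm s t]; exact key s t h
  · exact key t s h

theorem flow_semigroup {φ : ℝ → ℝ → ℝ} (h0 : ∀ y, 0 ≤ v y) (hC : ∀ y, v y ≤ C)
    (hflow : HasUniqueFlow v) (hφ : ∀ x, 0 ≤ x → IsReservePath v x (fun _ => 0) (φ x))
    {x s t : ℝ} (hx : 0 ≤ x) (hs : 0 ≤ s) (ht : 0 ≤ t) : φ x (s + t) = φ (φ x s) t := by
  have hxs : 0 ≤ φ x s := by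
    have := ((hφ x hx).sub_mem_Icc h0 hC le_rfl hs).1
    rw [(hφ x hx).zero_eq] at this
    linarith
  have hpath := hφ x hx
  have hW := IsReservePath.concat (U := φ x) (V := φ (φ x s)) (x := x) hs (hpath s hs).1
    (fun t h1 _ => by simpa using (hpath t h1).2)
    (by
      have := (hpath s hs).2
      rw [sub_zero] at this
      rw [← this]
      exact hφ _ hxs)
  have := (hflow x hx).2 _ _ hpath hW (s + t) (by linarith)
  simpa [not_lt.2 ht] using this

/-- Curves that change order meet by continuity, and after meeting they coincide by uniqueness. -/
theorem flow_mono {φ : ℝ → ℝ → ℝ} (h0 : ∀ y, 0 ≤ v y) (hC : ∀ y, v y ≤ C)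
    (hflow : HasUniqueFlow v) (hφ : ∀ x, 0 ≤ x → IsReservePath v x (fun _ => 0) (φ x))
    {x y t : ℝ} (hx : 0 ≤ x) (hxy : x ≤ y) (ht : 0 ≤ t) : φ x t ≤ φ y t := by
  by_contra! hlt
  have hy : 0 ≤ y := hx.trans hxy
  have hcont : Continuous fun u => φ y (max u 0) - φ x (max u 0) :=
    ((hφ y hy).continuous_max h0 hC).sub ((hφ x hx).continuous_max h0 hC)
  have hmem : (0 : ℝ) ∈ Set.Icc (φ y (max t 0) - φ x (max t 0))
      (φ y (max 0 0) - φ x (max 0 0)) := by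
    simp only [max_self, (hφ y hy).zero_eq, (hφ x hx).zero_eq, max_eq_left ht]
    constructor <;> linarith
  obtain ⟨s, hs, hs0⟩ := intermediate_value_Icc' ht hcont.continuousOn hmem
  simp only [max_eq_left hs.1] at hs0
  have e : φ y s = φ x s := by linarith
  have h1 := flow_semigroup h0 hC hflow hφ hx hs.1 (sub_nonneg.2 hs.2)
  have h2 := flow_semigroup h0 hC hflow hφ hy hs.1 (sub_nonneg.2 hs.2)
  rw [e, ← h1] at h2
  simp only [add_sub_cancel] at h2
  linarith

/-- The flow is continuous in time and monotone, hence measurable, in the initial level; together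
these give joint measurability. Truncating both arguments at `0` makes these properties global. -/
theorem exists_isFlow (h0 : ∀ y, 0 ≤ v y) (hC : ∀ y, v y ≤ C) (hflow : HasUniqueFlow v) :
    ∃ φ : ℝ → ℝ → ℝ, IsFlow v φ := by
  choose! φ hφ using fun x hx => (hflow x hx).1
  refine ⟨fun x t => φ (max x 0) (max t 0), ?_, fun x hx => ?_⟩
  · have h : Measurable (Function.uncurry fun t x => φ (max x 0) (max t 0)) := by
      refine measurable_uncurry_of_continuous_of_measurable (fun x => ?_) (fun t => ?_)
      · exact (hφ _ (le_max_right x 0)).continuous_max h0 hC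
      · refine Monotone.measurable fun x y hxy => ?_
        exact flow_mono h0 hC hflow hφ (le_max_right _ _) (max_le_max_right 0 hxy)
          (le_max_right _ _)
    exact h.comp measurable_swap
  · rw [max_eq_left hx]
    exact (hφ x hx).congr fun t ht => by rw [max_eq_left ht]

/-- Identifies the level just before the next claim: the path on `[0, s)` is continued by the flow,
and uniqueness applies to the result. -/
theorem IsFlow.eq_of_path (hflow : HasUniqueFlow v) (hφ : IsFlow v φ) {U : ℝ → ℝ} {y s : ℝ}
    (h0 : ∀ z, 0 ≤ v z) (hy : 0 ≤ y) (hs : 0 ≤ s)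
    (hint : IntervalIntegrable (fun u => v (U u)) volume 0 s)
    (hU : ∀ t, 0 ≤ t → t < s → U t = y + ∫ u in (0 : ℝ)..t, v (U u)) :
    y + ∫ u in (0 : ℝ)..s, v (U u) = φ y s := by
  have hL : 0 ≤ y + ∫ u in (0 : ℝ)..s, v (U u) :=
    add_nonneg hy (intervalIntegral.integral_nonneg hs fun u _ => h0 _)
  have hW := IsReservePath.concat hs hint hU (hφ.path _ hL)
  have := (hflow y hy).2 _ _ (hφ.path y hy) hW s hs
  simp only [lt_irrefl, if_false, sub_self, (hφ.path _ hL).zero_eq] at this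
  exact this.symm

theorem IsFlow.sub_mem_Icc (hφ : IsFlow v φ) (h0 : ∀ y, 0 ≤ v y) (hC : ∀ y, v y ≤ C)
    {x t : ℝ} (hx : 0 ≤ x) (ht : 0 ≤ t) : φ x t - x ∈ Set.Icc 0 (C * t) := by
  have := (hφ.path x hx).sub_mem_Icc h0 hC le_rfl ht
  rwa [(hφ.path x hx).zero_eq, sub_zero] at this

end Flow

/-! ### Reduction of ruin to the chain at claim epochs. -/

section Embedded

variable {Ω : Type*} {v : ℝ → ℝ} {φ : ℝ → ℝ → ℝ} {ξ τ : ℕ → Ω → ℝ} {ω : Ω}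

/-- One claim-to-claim transition of the reserve, absorbed once it is negative. -/
noncomputable def reserveStep (φ : ℝ → ℝ → ℝ) (y : ℝ) (z : ℝ × ℝ) : ℝ :=
  if y < 0 then y else φ y z.1 - z.2

/-- The reserve at claim epochs, absorbed at ruin. -/
noncomputable def embeddedChain (φ : ℝ → ℝ → ℝ) (ξ τ : ℕ → Ω → ℝ) (x : ℝ) : ℕ → Ω → ℝ
  | 0, _ => x
  | n + 1, ω => reserveStep φ (embeddedChain φ ξ τ x n ω) (τ n ω, ξ n ω)

theorem claimEpoch_succ (n : ℕ) : claimEpoch τ (n + 1) ω = claimEpoch τ n ω + τ n ω := by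
  simp [claimEpoch, Finset.sum_range_succ]

theorem claimEpoch_mono (hτ : ∀ n, 0 ≤ τ n ω) : Monotone fun n => claimEpoch τ n ω :=
  monotone_nat_of_le_succ fun n => by rw [claimEpoch_succ]; linarith [hτ n]

theorem claimEpoch_nonneg (hτ : ∀ n, 0 ≤ τ n ω) (n : ℕ) : 0 ≤ claimEpoch τ n ω :=
  Finset.sum_nonneg fun i _ => hτ i

theorem bddAbove_claimEpoch_le (hT : Tendsto (fun n => claimEpoch τ n ω) atTop atTop) (t : ℝ) :
    BddAbove {n : ℕ | claimEpoch τ n ω ≤ t} := by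
  obtain ⟨N, hN⟩ := (hT.eventually_gt_atTop t).exists_forall_of_atTop
  exact ⟨N, fun n hn => by
    by_contra! h
    exact absurd (hN n h.le) (not_lt.2 hn)⟩

theorem le_claimCount (hT : Tendsto (fun n => claimEpoch τ n ω) atTop atTop) {t : ℝ} {n : ℕ}
    (h : claimEpoch τ n ω ≤ t) : n ≤ claimCount τ t ω :=
  le_csSup (bddAbove_claimEpoch_le hT t) h

theorem claimCount_spec (hT : Tendsto (fun n => claimEpoch τ n ω) atTop atTop) {t : ℝ}
    (ht : 0 ≤ t) : claimEpoch τ (claimCount τ t ω) ω ≤ t ∧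
      t < claimEpoch τ (claimCount τ t ω + 1) ω := by
  constructor
  · exact Nat.sSup_mem ⟨0, by simpa [claimEpoch] using ht⟩ (bddAbove_claimEpoch_le hT t)
  · by_contra! h
    have := le_claimCount hT h
    omega

theorem claimCount_eq (hτ : ∀ n, 0 ≤ τ n ω)
    (hT : Tendsto (fun n => claimEpoch τ n ω) atTop atTop) {t : ℝ} {n : ℕ}
    (h1 : claimEpoch τ n ω ≤ t) (h2 : t < claimEpoch τ (n + 1) ω) : claimCount τ t ω = n := by
  refine le_antisymm ?_ (le_claimCount hT h1)
  by_contra! h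
  have h3 := (claimCount_spec hT ((claimEpoch_nonneg hτ n).trans h1)).1
  have h4 := claimEpoch_mono hτ (Nat.succ_le_of_lt h)
  simp only [Nat.succ_eq_add_one] at h4
  linarith

/-- `Y n` is the reserve after exactly `n` claims. The reserve does not decrease between claims, so
a negative value is inherited from the preceding epoch. -/
theorem ruin_iff_embeddedChain_neg (h0 : ∀ y, 0 ≤ v y) (hflow : HasUniqueFlow v)
    (hφ : IsFlow v φ) (hτ : ∀ n, 0 ≤ τ n ω) (hξ : ∀ n, 0 ≤ ξ n ω)
    (hT : Tendsto (fun n => claimEpoch τ n ω) atTop atTop) {x : ℝ} {r : ℝ → ℝ}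
    (hr : IsReservePath v x (aggregateClaims ξ τ ω) r) :
    (∃ t, 0 ≤ t ∧ r t < 0) ↔ ∃ n, embeddedChain φ ξ τ x n ω < 0 := by
  set T := fun n => claimEpoch τ n ω with hTdef
  set Y : ℕ → ℝ := fun n =>
    x + (∫ s in (0 : ℝ)..T n, v (r s)) - ∑ i ∈ Finset.range n, ξ i ω with hY
  have hT0 : ∀ n, 0 ≤ T n := claimEpoch_nonneg hτ
  have hTmono : Monotone T := claimEpoch_mono hτ
  have hint : ∀ a b, 0 ≤ a → 0 ≤ b → IntervalIntegrable (fun s => v (r s)) volume a b :=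
    fun a b ha hb => (hr a ha).1.symm.trans (hr b hb).1
  have hbetween : ∀ n t, T n ≤ t → t < T (n + 1) →
      r t = Y n + ∫ s in T n..t, v (r s) := by
    intro n t h1 h2
    have ht := (hT0 n).trans h1
    rw [(hr t ht).2, aggregateClaims, claimCount_eq hτ hT h1 h2, hY,
      ← intervalIntegral.integral_add_adjacent_intervals (hint 0 (T n) le_rfl (hT0 n))
        (hint (T n) t (hT0 n) ht)]
    ring
  have hruin : (∃ t, 0 ≤ t ∧ r t < 0) ↔ ∃ n, Y n < 0 := by
    constructor
    · rintro ⟨t, ht, hrt⟩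
      have hs := claimCount_spec hT ht
      refine ⟨claimCount τ t ω, ?_⟩
      have := hbetween _ t hs.1 hs.2
      have h2 : 0 ≤ ∫ s in T (claimCount τ t ω)..t, v (r s) :=
        intervalIntegral.integral_nonneg hs.1 fun u _ => h0 _
      linarith
    · rintro ⟨n, hn⟩
      refine ⟨T n, hT0 n, ?_⟩
      -- Inter-claim times may vanish, so more than `n` claims may have arrived by `T n`; the
      -- surplus claims only lower the reserve.
      have hle : n ≤ claimCount τ (T n) ω := le_claimCount hT le_rfl
      have hsum : ∑ i ∈ Finset.range n, ξ i ω ≤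
          ∑ i ∈ Finset.range (claimCount τ (T n) ω), ξ i ω :=
        Finset.sum_le_sum_of_subset_of_nonneg (Finset.range_mono hle) fun i _ _ => hξ i
      rw [(hr (T n) (hT0 n)).2, aggregateClaims]
      simp only [hY] at hn
      linarith
  have hstep : ∀ n, 0 ≤ Y n → Y (n + 1) = φ (Y n) (τ n ω) - ξ n ω := by
    intro n hn
    have hTs : T (n + 1) = T n + τ n ω := claimEpoch_succ n
    have hshift : ∀ t, (∫ u in (0 : ℝ)..t, v (r (T n + u))) = ∫ s in T n..T n + t, v (r s) := by
      intro t
      rw [intervalIntegral.integral_comp_add_left (fun s => v (r s)) (T n), add_zero]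
    have h := hφ.eq_of_path hflow (U := fun u => r (T n + u)) (y := Y n) (s := τ n ω) h0 hn (hτ n)
      (by
        have := (hint (T n) (T (n + 1)) (hT0 _) (hT0 _)).comp_add_left (T n)
        rw [hTs] at this
        simpa using this)
      (fun t ht1 ht2 => by
        rw [hshift]
        exact hbetween n _ (by linarith) (by rw [hTs]; linarith))
    rw [← h, hshift, ← hTs, hY]
    simp only [Finset.sum_range_succ]
    rw [← intervalIntegral.integral_add_adjacent_intervals (hint 0 (T n) le_rfl (hT0 n))
        (hint (T n) (T (n + 1)) (hT0 n) (hT0 _))]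
    ring
  -- The absorbed chain follows `Y` up to the first negative value; afterwards only the fact of ruin
  -- is kept.
  have hchain : ∀ n, embeddedChain φ ξ τ x n ω = Y n ∨
      (embeddedChain φ ξ τ x n ω < 0 ∧ ∃ k, Y k < 0) := by
    intro n
    induction n with
    | zero => left; simp [hY, embeddedChain, hTdef, claimEpoch]
    | succ n ih =>
      by_cases hneg : embeddedChain φ ξ τ x n ω < 0
      · right
        refine ⟨by simp [embeddedChain, reserveStep, hneg], ?_⟩
        rcases ih with h | h
        · exact ⟨n, h ▸ hneg⟩
        · exact h.2
      · left
        have h : embeddedChain φ ξ τ x n ω = Y n := by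
          rcases ih with h | h
          · exact h
          · exact absurd h.1 hneg
        rw [hstep n (by rw [← h]; exact not_lt.1 hneg), ← h]
        simp [embeddedChain, reserveStep, hneg]
  rw [hruin]
  constructor
  · rintro ⟨n, hn⟩
    refine ⟨n, ?_⟩
    rcases hchain n with h | h
    · rwa [h]
    · exact h.1
  · rintro ⟨n, hn⟩
    rcases hchain n with h | h
    · exact ⟨n, h ▸ hn⟩
    · exact h.2

theorem measurable_reserveStep (hφ : Measurable (Function.uncurry φ)) :
    Measurable fun p : ℝ × (ℝ × ℝ) => reserveStep φ p.1 p.2 := by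
  unfold reserveStep
  refine Measurable.ite (measurableSet_lt measurable_fst measurable_const) measurable_fst ?_
  exact (hφ.comp (measurable_fst.prodMk (measurable_fst.comp measurable_snd))).sub
    (measurable_snd.comp measurable_snd)

/-- The state after `n` steps depends only on the first `n` variables of each sequence (`true` for
claims, `false` for waiting times). Its independence from the next step rests on this. -/
theorem exists_embeddedChain_eq (hφ : Measurable (Function.uncurry φ)) (x : ℝ) (n : ℕ) :
    ∃ g : (((Finset.univ : Finset Bool) ×ˢ Finset.range n : Finset (Bool × ℕ)) → ℝ) → ℝ,
      Measurable g ∧ embeddedChain φ ξ τ x n =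
        g ∘ fun ω i => (if (i : Bool × ℕ).1 then ξ else τ) (i : Bool × ℕ).2 ω := by
  induction n with
  | zero => exact ⟨fun _ => x, measurable_const, rfl⟩
  | succ n ih =>
    obtain ⟨g, hg, hgeq⟩ := ih
    have hsub : ((Finset.univ : Finset Bool) ×ˢ Finset.range n : Finset (Bool × ℕ)) ⊆
        (Finset.univ : Finset Bool) ×ˢ Finset.range (n + 1) :=
      Finset.product_subset_product_right (Finset.range_mono n.le_succ)
    have hmem : ∀ b : Bool, (b, n) ∈
        ((Finset.univ : Finset Bool) ×ˢ Finset.range (n + 1) : Finset (Bool × ℕ)) := by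
      intro b; simp
    refine ⟨fun w => reserveStep φ (g fun i => w ⟨i, hsub i.2⟩)
      (w ⟨(false, n), hmem false⟩, w ⟨(true, n), hmem true⟩), ?_, ?_⟩
    · refine (measurable_reserveStep hφ).comp (Measurable.prodMk (hg.comp ?_) ?_) <;> fun_prop
    · funext ω
      simp only [embeddedChain, hgeq, Function.comp]
      simp

theorem tendsto_claimEpoch_atTop [MeasurableSpace Ω] {μ : Measure Ω}
    (hτ_ident : ∀ n, IdentDistrib (τ n) (τ 0) μ μ)
    (hτ_indep : iIndepFun τ μ) (hτ_pos : 0 < ∫ ω, τ 0 ω ∂μ) :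
    ∀ᵐ ω ∂μ, Tendsto (fun n => claimEpoch τ n ω) atTop atTop := by
  -- The integral of a non-integrable function is `0` by convention, so a positive mean forces
  -- integrability.
  have hint : Integrable (τ 0) μ := by
    by_contra h
    rw [integral_undef h] at hτ_pos
    exact lt_irrefl _ hτ_pos
  filter_upwards [strong_law_ae_real τ hint (fun i j hij => hτ_indep.indepFun hij) hτ_ident]
    with ω hω
  have h := hω.pos_mul_atTop hτ_pos tendsto_natCast_atTop_atTop
  refine h.congr' ?_
  filter_upwards [eventually_gt_atTop 0] with n hn
  have : (n : ℝ) ≠ 0 := by exact_mod_cast hn.ne'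
  rw [claimEpoch]
  field_simp

end Embedded

/-! ### Ruin probability through the transition operator. -/

section Law

open scoped ENNReal

variable {Ω : Type*} [MeasurableSpace Ω] {μ : Measure Ω} [IsProbabilityMeasure μ]
  {v : ℝ → ℝ} {φ : ℝ → ℝ → ℝ} {ξ τ : ℕ → Ω → ℝ}

theorem iIndepFun_bool_of_indepFun {β : Type*} [MeasurableSpace β] {f g : Ω → β}
    (h : IndepFun f g μ) : iIndepFun (fun (b : Bool) ω => if b then f ω else g ω) μ := by
  rw [iIndepFun_iff_measure_inter_preimage_eq_mul]
  intro S sets hsets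
  have hfg := indepFun_iff_measure_inter_preimage_eq_mul.1 h (sets true) (sets false)
  have hS : S = ∅ ∨ S = {true} ∨ S = {false} ∨ S = {true, false} := by
    clear hfg hsets; revert S; decide
  rcases hS with rfl | rfl | rfl | rfl
  · simp
  · simp
  · simp
  · simp only [Finset.mem_insert, Finset.mem_singleton, Set.iInter_iInter_eq_or_left,
      Set.iInter_iInter_eq_left, if_true, Bool.false_eq_true, if_false]
    rw [Finset.prod_insert (by simp), Finset.prod_singleton]
    exact hfg (hsets true (by simp)) (hsets false (by simp))

/-- Merges both sequences into one independent family, so that independence of disjoint blocks of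
indices becomes available. -/
theorem iIndepFun_interleave (hξ_meas : ∀ n, Measurable (ξ n)) (hτ_meas : ∀ n, Measurable (τ n))
    (hξ_indep : iIndepFun ξ μ) (hτ_indep : iIndepFun τ μ)
    (hξτ : IndepFun (fun ω n => ξ n ω) (fun ω n => τ n ω) μ) :
    iIndepFun (fun (p : Bool × ℕ) ω => (if p.1 then ξ else τ) p.2 ω) μ := by
  refine iIndepFun_uncurry' (X := fun (b : Bool) n ω => (if b then ξ else τ) n ω) ?_ ?_ ?_
  · intro b n; cases b
    · simpa using hτ_meas n
    · simpa using hξ_meas n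
  · convert iIndepFun_bool_of_indepFun hξτ using 3 with b ω
    cases b <;> rfl
  · intro b; cases b
    · simpa using hτ_indep
    · simpa using hξ_indep

theorem measurable_embeddedChain (hφ : Measurable (Function.uncurry φ))
    (hξ_meas : ∀ n, Measurable (ξ n)) (hτ_meas : ∀ n, Measurable (τ n)) (x : ℝ) (n : ℕ) :
    Measurable (embeddedChain φ ξ τ x n) := by
  induction n with
  | zero => exact measurable_const
  | succ n ih =>
    exact (measurable_reserveStep hφ).comp (ih.prodMk ((hτ_meas n).prodMk (hξ_meas n)))

theorem indepFun_embeddedChain (hφ : Measurable (Function.uncurry φ))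
    (hξ_meas : ∀ n, Measurable (ξ n)) (hτ_meas : ∀ n, Measurable (τ n))
    (hξ_indep : iIndepFun ξ μ) (hτ_indep : iIndepFun τ μ)
    (hξτ : IndepFun (fun ω n => ξ n ω) (fun ω n => τ n ω) μ) (x : ℝ) (n : ℕ) :
    IndepFun (embeddedChain φ ξ τ x n) (fun ω => (τ n ω, ξ n ω)) μ := by
  obtain ⟨g, hg, hgeq⟩ := exists_embeddedChain_eq (ξ := ξ) (τ := τ) hφ x n
  have hW := iIndepFun_interleave hξ_meas hτ_meas hξ_indep hτ_indep hξτ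
  have hWm : ∀ p : Bool × ℕ, Measurable fun ω => (if p.1 then ξ else τ) p.2 ω := by
    rintro ⟨b, k⟩; cases b
    · simpa using hτ_meas k
    · simpa using hξ_meas k
  have hdisj : Disjoint ((Finset.univ : Finset Bool) ×ˢ Finset.range n : Finset (Bool × ℕ))
      ((Finset.univ : Finset Bool) ×ˢ {n}) := by
    rw [Finset.disjoint_product]; right; simp
  have hind := hW.indepFun_finset _ _ hdisj hWm
  have hmem : ∀ b : Bool, (b, n) ∈
      ((Finset.univ : Finset Bool) ×ˢ {n} : Finset (Bool × ℕ)) := by intro b; simp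
  have := hind.comp (φ := g) (ψ := fun w => (w ⟨(false, n), hmem false⟩, w ⟨(true, n), hmem true⟩))
    hg (by fun_prop)
  rw [hgeq]
  convert this using 1
  funext ω
  simp

theorem map_pair_eq (hξ_meas : ∀ n, Measurable (ξ n)) (hτ_meas : ∀ n, Measurable (τ n))
    (hξ_ident : ∀ n, IdentDistrib (ξ n) (ξ 0) μ μ) (hτ_ident : ∀ n, IdentDistrib (τ n) (τ 0) μ μ)
    (hξτ : IndepFun (fun ω n => ξ n ω) (fun ω n => τ n ω) μ) (n : ℕ) :
    μ.map (fun ω => (τ n ω, ξ n ω)) = μ.map (fun ω => (τ 0 ω, ξ 0 ω)) := by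
  have h : ∀ k, μ.map (fun ω => (τ k ω, ξ k ω)) = (μ.map (τ k)).prod (μ.map (ξ k)) := by
    intro k
    rw [← indepFun_iff_map_prod_eq_prod_map_map (hτ_meas k).aemeasurable (hξ_meas k).aemeasurable]
    exact (hξτ.comp (measurable_pi_apply k) (measurable_pi_apply k)).symm
  rw [h, h, (hξ_ident n).map_eq, (hτ_ident n).map_eq]

/-- The transition operator of the chain with increments distributed as `ν`. -/
noncomputable def transition (φ : ℝ → ℝ → ℝ) (ν : Measure (ℝ × ℝ)) (f : ℝ → ℝ≥0∞) (y : ℝ) :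
    ℝ≥0∞ :=
  ∫⁻ z, f (reserveStep φ y z) ∂ν

variable {ν : Measure (ℝ × ℝ)} {f g : ℝ → ℝ≥0∞}

theorem measurable_transition [SFinite ν] (hφ : Measurable (Function.uncurry φ))
    (hf : Measurable f) : Measurable (transition φ ν f) :=
  Measurable.lintegral_prod_right' (f := fun p : ℝ × (ℝ × ℝ) => f (reserveStep φ p.1 p.2))
    (hf.comp (measurable_reserveStep hφ))

theorem transition_mono (h : f ≤ g) : transition φ ν f ≤ transition φ ν g :=
  fun _ => lintegral_mono fun _ => h _

theorem measurable_transition_iterate [SFinite ν] (hφ : Measurable (Function.uncurry φ))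
    (hf : Measurable f) (n : ℕ) : Measurable ((transition φ ν)^[n] f) := by
  induction n with
  | zero => exact hf
  | succ n ih => rw [Function.iterate_succ_apply']; exact measurable_transition hφ ih

/-- The probability, as a function of the initial state, that the chain becomes negative. -/
noncomputable def chainRuin (φ : ℝ → ℝ → ℝ) (ν : Measure (ℝ × ℝ)) (y : ℝ) : ℝ≥0∞ :=
  ⨆ n, (transition φ ν)^[n] ((Set.Iio 0).indicator 1) y

theorem measurable_indicator_Iio : Measurable ((Set.Iio (0 : ℝ)).indicator (1 : ℝ → ℝ≥0∞)) :=
  measurable_one.indicator measurableSet_Iio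

/-- Negative states are absorbing, so the `n`-th iterate is the probability of ruin within `n` steps
and grows with `n`. -/
theorem monotone_transition_iterate [IsProbabilityMeasure ν] :
    Monotone fun n => (transition φ ν)^[n] ((Set.Iio (0 : ℝ)).indicator 1) := by
  refine monotone_nat_of_le_succ fun n => ?_
  rw [Function.iterate_succ_apply]
  refine Monotone.iterate (fun _ _ h => transition_mono h) n fun y => ?_
  by_cases hy : y < 0
  · simp [transition, reserveStep, hy]
  · simp [hy]

theorem measurable_chainRuin [SFinite ν] (hφ : Measurable (Function.uncurry φ)) :
    Measurable (chainRuin φ ν) :=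
  Measurable.iSup fun n => measurable_transition_iterate hφ measurable_indicator_Iio n

/-- Harmonicity: monotone convergence moves the transition operator inside the supremum, and
shifting `n` by one does not change it. -/
theorem transition_chainRuin [IsProbabilityMeasure ν] (hφ : Measurable (Function.uncurry φ))
    (y : ℝ) : transition φ ν (chainRuin φ ν) y = chainRuin φ ν y := by
  have hm := monotone_transition_iterate (φ := φ) (ν := ν)
  unfold chainRuin
  simp only [transition]
  rw [lintegral_iSup]
  · have h2 : (⨆ n, (transition φ ν)^[n] ((Set.Iio 0).indicator 1) y) =
        ⨆ n, (transition φ ν)^[n + 1] ((Set.Iio 0).indicator 1) y :=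
      (Monotone.iSup_nat_add (f := fun n => (transition φ ν)^[n] ((Set.Iio 0).indicator 1) y)
        (fun a b hab => hm hab y) 1).symm
    refine Eq.trans ?_ h2.symm
    simp only [Function.iterate_succ_apply', transition]
  · intro n
    exact (measurable_transition_iterate hφ measurable_indicator_Iio n).comp
      ((measurable_reserveStep hφ).comp (measurable_const.prodMk measurable_id))
  · exact fun a b hab z => hm hab _

/-- Comparison principle, by induction on the number of steps: below `x₁` the trivial bound `1` is
enough, and above `x₁` superharmonicity of `F` carries the bound one step further. -/
theorem chainRuin_le {F : ℝ → ℝ≥0∞} {x₁ : ℝ} (hx₁ : 0 ≤ x₁) (h1 : ∀ y < x₁, 1 ≤ F y)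
    (h2 : ∀ y, x₁ ≤ y → transition φ ν F y ≤ F y) [IsProbabilityMeasure ν] (y : ℝ) :
    chainRuin φ ν y ≤ F y := by
  have hone : ∀ n y, (transition φ ν)^[n] ((Set.Iio (0 : ℝ)).indicator 1) y ≤ 1 := by
    intro n
    induction n with
    | zero => intro y; exact Set.indicator_le_self' (fun _ _ => zero_le) y
    | succ n ih =>
      intro y
      rw [Function.iterate_succ_apply']
      refine (lintegral_mono fun z => ih _).trans ?_
      simp
  refine iSup_le fun n => ?_
  induction n generalizing y with
  | zero =>
    by_cases hy : y < x₁
    · exact (hone 0 y).trans (h1 y hy)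
    · have : ¬ y < 0 := fun h => hy (h.trans_le hx₁)
      simp [this]
  | succ n ih =>
    by_cases hy : y < x₁
    · exact (hone _ y).trans (h1 y hy)
    · rw [Function.iterate_succ_apply']
      exact (transition_mono ih y).trans (h2 y (not_lt.1 hy))

theorem chainRuin_le_one [IsProbabilityMeasure ν] (y : ℝ) : chainRuin φ ν y ≤ 1 :=
  chainRuin_le (F := fun _ => 1) le_rfl (fun _ _ => le_rfl) (fun y _ => by simp [transition]) y

theorem chainRuin_of_neg [IsProbabilityMeasure ν] {y : ℝ} (hy : y < 0) : chainRuin φ ν y = 1 := by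
  refine le_antisymm (chainRuin_le_one y) ?_
  refine le_trans ?_ (le_iSup _ 0)
  simp [hy]

/-- The Markov property: the last step is independent of the current state, so it can be integrated
first. -/
theorem lintegral_embeddedChain (hφ : Measurable (Function.uncurry φ))
    (hξ_meas : ∀ n, Measurable (ξ n)) (hτ_meas : ∀ n, Measurable (τ n))
    (hξ_ident : ∀ n, IdentDistrib (ξ n) (ξ 0) μ μ) (hτ_ident : ∀ n, IdentDistrib (τ n) (τ 0) μ μ)
    (hξ_indep : iIndepFun ξ μ) (hτ_indep : iIndepFun τ μ)
    (hξτ : IndepFun (fun ω n => ξ n ω) (fun ω n => τ n ω) μ) (x : ℝ) (n : ℕ)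
    (hf : Measurable f) :
    ∫⁻ ω, f (embeddedChain φ ξ τ x n ω) ∂μ =
      (transition φ (μ.map fun ω => (τ 0 ω, ξ 0 ω)))^[n] f x := by
  have hpm : Measurable fun ω => (τ 0 ω, ξ 0 ω) := (hτ_meas 0).prodMk (hξ_meas 0)
  have : IsProbabilityMeasure (μ.map fun ω => (τ 0 ω, ξ 0 ω)) :=
    Measure.isProbabilityMeasure_map hpm.aemeasurable
  induction n generalizing f with
  | zero => simp [embeddedChain]
  | succ n ih =>
    rw [Function.iterate_succ_apply, ← ih (measurable_transition hφ hf)]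
    have hc := measurable_embeddedChain hφ hξ_meas hτ_meas x n
    have hpn : Measurable fun ω => (τ n ω, ξ n ω) := (hτ_meas n).prodMk (hξ_meas n)
    have hind := indepFun_embeddedChain hφ hξ_meas hτ_meas hξ_indep hτ_indep hξτ x n
    rw [indepFun_iff_map_prod_eq_prod_map_map hc.aemeasurable hpn.aemeasurable,
      map_pair_eq hξ_meas hτ_meas hξ_ident hτ_ident hξτ n] at hind
    have hF : Measurable fun p : ℝ × (ℝ × ℝ) => f (reserveStep φ p.1 p.2) :=
      hf.comp (measurable_reserveStep hφ)
    have e1 : ∫⁻ ω, f (embeddedChain φ ξ τ x (n + 1) ω) ∂μ =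
        ∫⁻ p, f (reserveStep φ p.1 p.2)
          ∂(μ.map fun ω => (embeddedChain φ ξ τ x n ω, (τ n ω, ξ n ω))) := by
      rw [lintegral_map hF (hc.prodMk hpn)]
      rfl
    rw [e1, hind, lintegral_prod _ hF.aemeasurable,
      lintegral_map (measurable_transition hφ hf) hc |>.symm]
    rfl

theorem ruinProb_eq_chainRuin (hξ_meas : ∀ n, Measurable (ξ n)) (hτ_meas : ∀ n, Measurable (τ n))
    (hξ_nonneg : ∀ n, ∀ᵐ ω ∂μ, 0 ≤ ξ n ω) (hτ_nonneg : ∀ n, ∀ᵐ ω ∂μ, 0 ≤ τ n ω)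
    (hξ_ident : ∀ n, IdentDistrib (ξ n) (ξ 0) μ μ) (hτ_ident : ∀ n, IdentDistrib (τ n) (τ 0) μ μ)
    (hξ_indep : iIndepFun ξ μ) (hτ_indep : iIndepFun τ μ)
    (hξτ : IndepFun (fun ω n => ξ n ω) (fun ω n => τ n ω) μ)
    (hτ_pos : 0 < ∫ ω, τ 0 ω ∂μ) (h0 : ∀ y, 0 ≤ v y) (hflow : HasUniqueFlow v)
    (hφ : IsFlow v φ) {R : ℝ → ℝ → Ω → ℝ} (hR : IsRiskProcess μ v ξ τ R) {x : ℝ} (hx : 0 ≤ x) :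
    ruinProb μ R x = (chainRuin φ (μ.map fun ω => (τ 0 ω, ξ 0 ω)) x).toReal := by
  have hpm : Measurable fun ω => (τ 0 ω, ξ 0 ω) := (hτ_meas 0).prodMk (hξ_meas 0)
  have : IsProbabilityMeasure (μ.map fun ω => (τ 0 ω, ξ 0 ω)) :=
    Measure.isProbabilityMeasure_map hpm.aemeasurable
  -- The ruin event is not known to be measurable, but it agrees almost surely with a countable
  -- union of measurable events.
  have hset : μ {ω | ∃ t : ℝ, 0 ≤ t ∧ R x t ω < 0} =
      μ (⋃ n, {ω | embeddedChain φ ξ τ x n ω < 0}) := by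
    refine measure_congr ?_
    filter_upwards [hR x hx, tendsto_claimEpoch_atTop hτ_ident hτ_indep hτ_pos,
      ae_all_iff.2 hξ_nonneg, ae_all_iff.2 hτ_nonneg] with ω h1 h2 h3 h4
    have := ruin_iff_embeddedChain_neg h0 hflow hφ h4 h3 h2 h1
    refine propext ?_
    change (∃ t : ℝ, 0 ≤ t ∧ R x t ω < 0) ↔ ω ∈ ⋃ n, {ω | embeddedChain φ ξ τ x n ω < 0}
    simpa using this
  have hmono : Monotone fun n => {ω | embeddedChain φ ξ τ x n ω < 0} := by
    refine monotone_nat_of_le_succ fun n => ?_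
    intro ω hω
    rw [Set.mem_ofPred_eq] at hω ⊢
    simp [embeddedChain, reserveStep, hω]
  rw [ruinProb, Measure.real, hset, hmono.measure_iUnion, chainRuin]
  congr 1
  refine iSup_congr fun n => ?_
  rw [← lintegral_embeddedChain hφ.measurable hξ_meas hτ_meas hξ_ident hτ_ident hξ_indep hτ_indep
    hξτ x n measurable_indicator_Iio]
  have hms : MeasurableSet {ω | embeddedChain φ ξ τ x n ω < 0} :=
    measurableSet_lt (measurable_embeddedChain hφ.measurable hξ_meas hτ_meas x n) measurable_const
  rw [← lintegral_indicator_one hms]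
  rfl

end Law

/-! ### Regular integrable majorants. -/

section Rates

theorem integral_Ioi_eq_sub {f : ℝ → ℝ} {a x : ℝ} (hf : IntegrableOn f (Set.Ioi a))
    (hx : a ≤ x) :
    ∫ y in Set.Ioi x, f y = (∫ y in Set.Ioi a, f y) - ∫ y in a..x, f y := by
  rw [intervalIntegral.integral_of_le hx, ← Set.Ioc_union_Ioi_eq_Ioi hx,
    setIntegral_union (Set.Ioc_disjoint_Ioi le_rfl) measurableSet_Ioi
      (hf.mono_set Set.Ioc_subset_Ioi_self) (hf.mono_set (Set.Ioi_subset_Ioi hx))]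
  ring

theorem tendsto_integral_Ioi_atTop_zero {f : ℝ → ℝ} {a : ℝ} (hf : IntegrableOn f (Set.Ioi a)) :
    Tendsto (fun x => ∫ y in Set.Ioi x, f y) atTop (𝓝 0) := by
  have h1 := intervalIntegral_tendsto_integral_Ioi a hf tendsto_id
  have h2 : Tendsto (fun x => (∫ y in Set.Ioi a, f y) - ∫ y in a..x, f y) atTop (𝓝 0) := by
    simpa using (tendsto_const_nhds (x := ∫ y in Set.Ioi a, f y)).sub h1
  refine h2.congr' ?_
  filter_upwards [eventually_ge_atTop a] with x hx
  exact (integral_Ioi_eq_sub hf hx).symm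

theorem hasDerivAt_integral_Ioi {f : ℝ → ℝ} {a z : ℝ} (hf : IntegrableOn f (Set.Ioi a))
    (haz : a < z) (hc : ContinuousAt f z) :
    HasDerivAt (fun x => ∫ y in Set.Ioi x, f y) (-f z) z := by
  have hi : IntervalIntegrable f volume a z :=
    (intervalIntegrable_iff_integrableOn_Ioc_of_le haz.le).2
      (hf.mono_set Set.Ioc_subset_Ioi_self)
  have hm : StronglyMeasurableAtFilter f (𝓝 z) volume :=
    ⟨Set.Ioi a, Ioi_mem_nhds haz, hf.aestronglyMeasurable⟩
  have h := (intervalIntegral.integral_hasDerivAt_right hi hm hc).const_sub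
    (∫ y in Set.Ioi a, f y)
  refine h.congr_of_eventuallyEq ?_
  filter_upwards [Ioi_mem_nhds haz] with x hx
  have hx : a ≤ x := le_of_lt hx
  exact integral_Ioi_eq_sub hf hx

/-- By monotonicity `(x / 2) f(x) ≤ ∫_{x/2}^x f`, which is at most a vanishing tail. -/
theorem tendsto_mul_of_antitoneOn_integrableOn {f : ℝ → ℝ} {a : ℝ}
    (hanti : AntitoneOn f (Set.Ioi a)) (hf : IntegrableOn f (Set.Ioi a))
    (h0 : ∀ x, a < x → 0 ≤ f x) : Tendsto (fun x => x * f x) atTop (𝓝 0) := by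
  have h1 := ((tendsto_integral_Ioi_atTop_zero hf).comp
    (tendsto_id.atTop_div_const (show (0 : ℝ) < 2 by norm_num))).const_mul 2
  rw [mul_zero] at h1
  refine squeeze_zero' ?_ ?_ h1
  · filter_upwards [eventually_gt_atTop a, eventually_ge_atTop 0] with x hx hx0
    exact mul_nonneg hx0 (h0 x hx)
  · filter_upwards [eventually_gt_atTop 0, eventually_gt_atTop (2 * a)] with x hx hxa
    have hlt : a < x / 2 := by linarith
    have h2 : ∫ _ in Set.Ioc (x / 2) x, f x ≤ ∫ y in Set.Ioc (x / 2) x, f y := by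
      refine setIntegral_mono_on (integrableOn_const (by simp)) ?_ measurableSet_Ioc ?_
      · exact hf.mono_set fun y hy => hlt.trans hy.1
      · intro y hy
        exact hanti (hlt.trans hy.1) (show a < x by linarith) hy.2
    have h3 : ∫ y in Set.Ioc (x / 2) x, f y ≤ ∫ y in Set.Ioi (x / 2), f y := by
      refine setIntegral_mono_set (hf.mono_set (Set.Ioi_subset_Ioi hlt.le)) ?_
        (LE.le.eventuallyLE Set.Ioc_subset_Ioi_self)
      exact (ae_restrict_mem measurableSet_Ioi).mono fun y hy => h0 y (hlt.trans hy)
    rw [setIntegral_const, Measure.real, Real.volume_Ioc, ENNReal.toReal_ofReal (by linarith),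
      smul_eq_mul] at h2
    simp only [Function.comp, id]
    linarith

/-- A positive integrable decreasing function that decreases at most quadratically. -/
structure IsSlowRate (q : ℝ → ℝ) : Prop where
  anti : AntitoneOn q (Set.Ioi 0)
  mono_sq : MonotoneOn (fun x => x ^ 2 * q x) (Set.Ioi 0)
  pos : ∀ x, 0 < x → 0 < q x
  integrable : IntegrableOn q (Set.Ioi 0)

variable {q : ℝ → ℝ}

theorem IsSlowRate.const_mul (hq : IsSlowRate q) {c : ℝ} (hc : 0 < c) :
    IsSlowRate fun x => c * q x where
  anti := fun x hx y hy h => mul_le_mul_of_nonneg_left (hq.anti hx hy h) hc.le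
  mono_sq := fun x hx y hy h => by
    have := mul_le_mul_of_nonneg_left (hq.mono_sq hx hy h) hc.le
    simp only at this ⊢
    linarith
  pos := fun x hx => mul_pos hc (hq.pos x hx)
  integrable := hq.integrable.const_mul c

theorem IsSlowRate.le_four_mul (hq : IsSlowRate q) {x z : ℝ} (hx : 0 < x) (hz : x / 2 ≤ z) :
    q z ≤ 4 * q x := by
  have hz0 : 0 < z := by linarith
  have hqx := hq.pos x hx
  rcases le_total x z with h | h
  · have := hq.anti hx hz0 h
    linarith
  · have h1 := hq.mono_sq hz0 hx h
    simp only at h1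
    have h2 : x ^ 2 ≤ 4 * z ^ 2 := by nlinarith
    have h3 : z ^ 2 * q z ≤ z ^ 2 * (4 * q x) := by nlinarith
    exact le_of_mul_le_mul_left h3 (by positivity)

/-- The two monotonicity conditions together replace the derivative bound `|q'| ≤ 2 q / x`; no
differentiability of `q` is needed. -/
theorem IsSlowRate.abs_sub_le (hq : IsSlowRate q) {x z : ℝ} (hx : 0 < x) (hz : x / 2 ≤ z) :
    |q z - q x| ≤ 8 * q x / x * |z - x| := by
  have hz0 : 0 < z := by linarith
  have hqx := hq.pos x hx
  rcases le_total x z with h | h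
  · have h1 := hq.anti hx hz0 h
    have h2 := hq.mono_sq hx hz0 h
    simp only at h2
    rw [abs_of_nonpos (by linarith), abs_of_nonneg (by linarith), div_mul_eq_mul_div,
      le_div_iff₀ hx]
    have h3 : z ^ 2 * ((q x - q z) * x) ≤ z ^ 2 * (8 * q x * (z - x)) := by
      have e1 : z ^ 2 * ((q x - q z) * x) ≤ (z ^ 2 - x ^ 2) * q x * x := by nlinarith
      have e2 : (z ^ 2 - x ^ 2) * q x * x = (q x * (z - x)) * ((z + x) * x) := by ring
      have e3 : (z + x) * x ≤ 8 * z ^ 2 := by nlinarith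
      have e4 : 0 ≤ q x * (z - x) := mul_nonneg hqx.le (by linarith)
      nlinarith
    have := le_of_mul_le_mul_left h3 (by positivity)
    linarith
  · have h1 := hq.anti hz0 hx h
    have h2 := hq.mono_sq hz0 hx h
    simp only at h2
    rw [abs_of_nonneg (by linarith), abs_of_nonpos (by linarith), div_mul_eq_mul_div,
      le_div_iff₀ hx]
    have h3 : z ^ 2 * ((q z - q x) * x) ≤ z ^ 2 * (8 * q x * (x - z)) := by
      have e1 : z ^ 2 * ((q z - q x) * x) ≤ (x ^ 2 - z ^ 2) * q x * x := by nlinarith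
      have e2 : (x ^ 2 - z ^ 2) * q x * x = (q x * (x - z)) * ((x + z) * x) := by ring
      have e3 : (x + z) * x ≤ 8 * z ^ 2 := by nlinarith
      have e4 : 0 ≤ q x * (x - z) := mul_nonneg hqx.le (by linarith)
      nlinarith
    have := le_of_mul_le_mul_left h3 (by positivity)
    linarith

theorem IsSlowRate.continuousAt (hq : IsSlowRate q) {x : ℝ} (hx : 0 < x) : ContinuousAt q x := by
  rw [ContinuousAt, tendsto_iff_dist_tendsto_zero]
  have h1 : Tendsto (fun z => 8 * q x / x * |z - x|) (𝓝 x) (𝓝 0) := by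
    have : Continuous fun z => 8 * q x / x * |z - x| := by fun_prop
    simpa using this.tendsto x
  refine squeeze_zero' (Eventually.of_forall fun _ => dist_nonneg) ?_ h1
  filter_upwards [Ioi_mem_nhds (show x / 2 < x by linarith)] with z hz
  exact hq.abs_sub_le hx (le_of_lt hz)

/-- Take `q(x) = 2 ∫₀¹ s d(xs) ds = 2 x⁻² ∫₀ˣ y d(y) dy`. The first form shows that `q` decreases
and, since `∫₀¹ s ds = 1/2`, that `q ≥ d`; the second shows that `x² q` increases. Tonelli gives
integrability, as `∫ s d(xs) dx` does not depend on `s`. -/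
theorem exists_isSlowRate {e : ℝ → ℝ} (hanti : AntitoneOn e (Set.Ioi 1))
    (hpos : ∀ x, 1 < x → 0 < e x) (hint : IntegrableAtFilter e atTop) :
    ∃ q, IsSlowRate q ∧ ∀ x, 2 ≤ x → e x ≤ q x := by
  -- Freezing `e` below `2` gives a function that decreases on the whole line and is bounded near
  -- `0`.
  set d : ℝ → ℝ := fun x => e (max x 2) with hd
  have h2 : ∀ x : ℝ, (1 : ℝ) < max x 2 := fun x => lt_max_of_lt_right (by norm_num)
  have hdanti : Antitone d := fun x y h => hanti (h2 x) (h2 y) (max_le_max_right 2 h)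
  have hdpos : ∀ x, 0 < d x := fun x => hpos _ (h2 x)
  have hdint : IntegrableOn d (Set.Ioi 0) := by
    obtain ⟨s, hs, hse⟩ := hint
    obtain ⟨a, ha⟩ := mem_atTop_sets.1 hs
    have hIoi : IntegrableOn d (Set.Ioi (max a 2)) := by
      refine (hse.mono_set fun x hx => ha x ((le_max_left a 2).trans (le_of_lt hx))).congr_fun
        (fun x hx => ?_) measurableSet_Ioi
      have : 2 ≤ x := (le_max_right a 2).trans (le_of_lt hx)
      simp [hd, max_eq_left this]
    have hIcc : IntegrableOn d (Set.Icc 0 (max a 2)) :=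
      (hdanti.antitoneOn _).integrableOn_isCompact isCompact_Icc
    refine (hIcc.union hIoi).mono_set fun x hx => ?_
    rcases le_or_gt x (max a 2) with h | h
    · exact Or.inl ⟨le_of_lt hx, h⟩
    · exact Or.inr h
  have hyd : ∀ a b, IntervalIntegrable (fun y => y * d y) volume a b := fun a b =>
    hdanti.intervalIntegrable.continuousOn_mul continuous_id.continuousOn
  have hsd : ∀ x, 0 < x → IntervalIntegrable (fun s => s * d (x * s)) volume 0 1 := by
    intro x hx
    have : Antitone fun s => d (x * s) := fun s t h =>
      hdanti (mul_le_mul_of_nonneg_left h hx.le)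
    exact this.intervalIntegrable.continuousOn_mul continuous_id.continuousOn
  set q : ℝ → ℝ := fun x => 2 * ∫ s in (0 : ℝ)..1, s * d (x * s) with hqdef
  have hsq : ∀ x, 0 < x → x ^ 2 * q x = 2 * ∫ y in (0 : ℝ)..x, y * d y := by
    intro x hx
    have h := intervalIntegral.mul_integral_comp_mul_left (a := 0) (b := 1)
      (f := fun y => y * d y) x
    rw [mul_zero, mul_one] at h
    rw [← h, hqdef]
    simp only
    have : ∀ s, x * s * d (x * s) = x * (s * d (x * s)) := fun s => by ring
    simp_rw [this]
    rw [intervalIntegral.integral_const_mul]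
    ring
  have hge : ∀ x, 0 < x → d x ≤ q x := by
    intro x hx
    have h1 : ∫ s in (0 : ℝ)..1, s * d x ≤ ∫ s in (0 : ℝ)..1, s * d (x * s) := by
      refine intervalIntegral.integral_mono_on zero_le_one
        ((continuous_id.mul continuous_const).intervalIntegrable _ _) (hsd x hx) fun s hs => ?_
      exact mul_le_mul_of_nonneg_left (hdanti (by nlinarith [hs.2])) hs.1
    rw [intervalIntegral.integral_mul_const, integral_id] at h1
    simp only [hqdef]
    linarith
  refine ⟨q, ⟨?_, ?_, fun x hx => (hdpos x).trans_le (hge x hx), ?_⟩, fun x hx => ?_⟩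
  · intro x hx y hy hxy
    refine mul_le_mul_of_nonneg_left ?_ zero_le_two
    refine intervalIntegral.integral_mono_on zero_le_one (hsd y hy) (hsd x hx) fun s hs => ?_
    exact mul_le_mul_of_nonneg_left (hdanti (mul_le_mul_of_nonneg_right hxy hs.1)) hs.1
  · intro x hx y hy hxy
    simp only
    rw [hsq x hx, hsq y hy]
    refine mul_le_mul_of_nonneg_left ?_ zero_le_two
    refine intervalIntegral.integral_mono_interval le_rfl (le_of_lt hx) hxy ?_ (hyd 0 y)
    refine (ae_restrict_mem measurableSet_Ioc).mono fun u hu => ?_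
    exact mul_nonneg hu.1.le (hdpos u).le
  · have hmeas : Measurable fun p : ℝ × ℝ => p.2 * d (p.1 * p.2) :=
      measurable_snd.mul (hdanti.measurable.comp (measurable_fst.mul measurable_snd))
    have hinner : ∀ s : ℝ, s ∈ Set.Ioc (0 : ℝ) 1 →
        IntegrableOn (fun x => s * d (x * s)) (Set.Ioi 0) ∧
        ∫ x in Set.Ioi (0 : ℝ), ‖s * d (x * s)‖ = ∫ x in Set.Ioi (0 : ℝ), d x := by
      intro s hs
      constructor
      · have := (integrableOn_Ioi_comp_mul_right_iff d 0 hs.1).2 (by simpa using hdint)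
        exact this.const_mul s
      · have e1 : ∀ x, ‖s * d (x * s)‖ = s * d (x * s) := fun x =>
          Real.norm_of_nonneg (mul_nonneg hs.1.le (hdpos _).le)
        simp_rw [e1]
        rw [integral_const_mul, integral_comp_mul_right_Ioi d 0 hs.1]
        rw [zero_mul, smul_eq_mul, ← mul_assoc, mul_inv_cancel₀ hs.1.ne', one_mul]
    have hprod : Integrable (fun p : ℝ × ℝ => p.2 * d (p.1 * p.2))
        ((volume.restrict (Set.Ioi 0)).prod (volume.restrict (Set.Ioc 0 1))) := by
      rw [integrable_prod_iff' hmeas.aestronglyMeasurable]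
      constructor
      · exact (ae_restrict_mem measurableSet_Ioc).mono fun s hs => (hinner s hs).1
      · have hc : Integrable (fun _ : ℝ => ∫ x in Set.Ioi (0 : ℝ), d x)
            (volume.restrict (Set.Ioc (0 : ℝ) 1)) := integrable_const _
        exact hc.congr ((ae_restrict_mem measurableSet_Ioc).mono fun s hs => (hinner s hs).2.symm)
    have := hprod.integral_prod_left.const_mul 2
    refine this.congr (Eventually.of_forall fun x => ?_)
    simp only [hqdef]
    rw [intervalIntegral.integral_of_le zero_le_one]
  · have := hge x (by linarith)
    simpa [hd, max_eq_left hx] using this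

end Rates

/-! ### The perturbed power function and its Taylor remainder. -/

section Lyapunov

/-- The tail integral of a rate. -/
noncomputable def rateTail (q : ℝ → ℝ) (x : ℝ) : ℝ := ∫ y in Set.Ioi x, q y

/-- Minus the derivative of the Lyapunov function. -/
noncomputable def lyapunovDensity (ρ s : ℝ) (q : ℝ → ℝ) (x : ℝ) : ℝ :=
  x ^ (-(ρ + 1)) * (1 + s * rateTail q x)

/-- The second derivative of the Lyapunov function. -/
noncomputable def lyapunovCurvature (ρ s : ℝ) (q : ℝ → ℝ) (x : ℝ) : ℝ :=
  (ρ + 1) * (x ^ (-(ρ + 2)) * (1 + s * rateTail q x)) + s * (x ^ (-(ρ + 1)) * q x)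

/-- A perturbation of `x ^ (-ρ) / ρ`, frozen below `x₀`. -/
noncomputable def lyapunov (ρ s : ℝ) (q : ℝ → ℝ) (x₀ x : ℝ) : ℝ :=
  ∫ y in Set.Ioi (max x x₀), lyapunovDensity ρ s q y

/-- The perturbation with rate `q` is small on `[x₀, ∞)`. -/
structure IsPerturbation (ρ s : ℝ) (q : ℝ → ℝ) (x₀ : ℝ) : Prop where
  exponent_pos : 0 < ρ
  abs_sign : |s| ≤ 1
  one_le : 1 ≤ x₀
  slow : IsSlowRate q
  tail_le : ∀ x, x₀ ≤ x → rateTail q x ≤ 1 / 2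
  mul_le : ∀ x, x₀ ≤ x → x * q x ≤ 1

variable {ρ s x₀ : ℝ} {q : ℝ → ℝ}

theorem abs_rpow_neg_sub_le {α x z : ℝ} (hα : 0 < α) (hx : 0 < x) (hz : x / 2 ≤ z) :
    |z ^ (-α) - x ^ (-α)| ≤ α * 2 ^ (α + 1) * x ^ (-(α + 1)) * |z - x| := by
  have hx2 : 0 < x / 2 := by linarith
  have h := Convex.norm_image_sub_le_of_norm_hasDerivWithin_le (𝕜 := ℝ) (s := Set.Ici (x / 2))
    (f := fun y => y ^ (-α)) (f' := fun y => -α * y ^ (-α - 1)) (x := x) (y := z)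
    (C := α * 2 ^ (α + 1) * x ^ (-(α + 1))) ?_ ?_ (convex_Ici _)
    (by rw [Set.mem_Ici]; linarith) hz
  · simpa [Real.norm_eq_abs] using h
  · intro y hy
    have hy0 : y ≠ 0 := (hx2.trans_le hy).ne'
    exact (Real.hasDerivAt_rpow_const (Or.inl hy0)).hasDerivWithinAt
  · intro y hy
    have hy0 : 0 < y := hx2.trans_le hy
    rw [norm_mul, norm_neg, Real.norm_of_nonneg hα.le, Real.norm_of_nonneg (by positivity),
      mul_assoc]
    refine mul_le_mul_of_nonneg_left ?_ hα.le
    have e : (2 : ℝ) ^ (α + 1) * x ^ (-(α + 1)) = (x / 2) ^ (-(α + 1)) := by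
      rw [Real.div_rpow hx.le (by norm_num), Real.rpow_neg (by norm_num : (0 : ℝ) ≤ 2)]
      field_simp
    rw [e, show -α - 1 = -(α + 1) by ring]
    exact Real.rpow_le_rpow_of_nonpos hx2 hy (by linarith)

/-- Powers are normalised to `x ^ (-(ρ + 3))`, the order of a third derivative, so that later
comparisons are polynomial in `x`. -/
theorem rpow_neg_add_two {x : ℝ} (hx : 0 < x) (ρ : ℝ) :
    x ^ (-(ρ + 2)) = x ^ (-(ρ + 3)) * x := by
  rw [show -(ρ + 2) = -(ρ + 3) + 1 by ring, Real.rpow_add_one hx.ne']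

theorem rpow_neg_add_one {x : ℝ} (hx : 0 < x) (ρ : ℝ) :
    x ^ (-(ρ + 1)) = x ^ (-(ρ + 3)) * x ^ 2 := by
  rw [show -(ρ + 1) = -(ρ + 3) + 1 + 1 by ring, Real.rpow_add_one hx.ne',
    Real.rpow_add_one hx.ne']
  ring

theorem rpow_neg_eq {x : ℝ} (hx : 0 < x) (ρ : ℝ) :
    x ^ (-ρ) = x ^ (-(ρ + 3)) * x ^ 3 := by
  rw [show -ρ = -(ρ + 3) + 1 + 1 + 1 by ring, Real.rpow_add_one hx.ne',
    Real.rpow_add_one hx.ne', Real.rpow_add_one hx.ne']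
  ring

namespace IsPerturbation

theorem pos (h : IsPerturbation ρ s q x₀) {x : ℝ} (hx : x₀ ≤ x) : 0 < x := by
  linarith [h.one_le]

theorem tail_nonneg (h : IsPerturbation ρ s q x₀) {x : ℝ} (hx : 0 ≤ x) : 0 ≤ rateTail q x :=
  setIntegral_nonneg measurableSet_Ioi fun y hy => (h.slow.pos y (hx.trans_lt hy)).le

theorem factor_mem (h : IsPerturbation ρ s q x₀) {x : ℝ} (hx : x₀ ≤ x) :
    1 / 2 ≤ 1 + s * rateTail q x ∧ 1 + s * rateTail q x ≤ 3 / 2 := by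
  have h1 := h.tail_le x hx
  have h2 := h.tail_nonneg (h.pos hx).le
  have h3 : |s * rateTail q x| ≤ 1 / 2 := by
    rw [abs_mul, abs_of_nonneg h2]
    nlinarith [h.abs_sign]
  have := abs_le.1 h3
  constructor <;> linarith

theorem hasDerivAt_tail (h : IsPerturbation ρ s q x₀) {x : ℝ} (hx : 0 < x) :
    HasDerivAt (rateTail q) (-q x) x :=
  hasDerivAt_integral_Ioi h.slow.integrable hx (h.slow.continuousAt hx)

theorem hasDerivAt_density (h : IsPerturbation ρ s q x₀) {x : ℝ} (hx : 0 < x) :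
    HasDerivAt (lyapunovDensity ρ s q) (-lyapunovCurvature ρ s q x) x := by
  have h1 : HasDerivAt (fun y : ℝ => y ^ (-(ρ + 1))) (-(ρ + 1) * x ^ (-(ρ + 1) - 1)) x :=
    Real.hasDerivAt_rpow_const (Or.inl hx.ne')
  have h2 := h1.mul (((h.hasDerivAt_tail hx).const_mul s).const_add 1)
  refine h2.congr_deriv ?_
  rw [lyapunovCurvature, show -(ρ + 1) - 1 = -(ρ + 2) by ring]
  ring

theorem density_mem (h : IsPerturbation ρ s q x₀) {x : ℝ} (hx : x₀ ≤ x) :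
    x ^ (-(ρ + 1)) / 2 ≤ lyapunovDensity ρ s q x ∧
      lyapunovDensity ρ s q x ≤ 3 / 2 * x ^ (-(ρ + 1)) := by
  have h1 := h.factor_mem hx
  have h2 : 0 < x ^ (-(ρ + 1)) := Real.rpow_pos_of_pos (h.pos hx) _
  unfold lyapunovDensity
  constructor <;> nlinarith

theorem continuousOn_density (h : IsPerturbation ρ s q x₀) :
    ContinuousOn (lyapunovDensity ρ s q) (Set.Ioi 0) :=
  fun _ hx => (h.hasDerivAt_density hx).continuousAt.continuousWithinAt

theorem integrableOn_density (h : IsPerturbation ρ s q x₀) :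
    IntegrableOn (lyapunovDensity ρ s q) (Set.Ioi x₀) := by
  have hx₀ : 0 < x₀ := h.pos le_rfl
  have h1 : IntegrableOn (fun y : ℝ => 3 / 2 * y ^ (-(ρ + 1))) (Set.Ioi x₀) :=
    (integrableOn_Ioi_rpow_of_lt (by linarith [h.exponent_pos]) hx₀).const_mul _
  refine Integrable.mono' h1 ?_ ?_
  · exact (h.continuousOn_density.mono (Set.Ioi_subset_Ioi hx₀.le)).aestronglyMeasurable
      measurableSet_Ioi
  · refine (ae_restrict_mem measurableSet_Ioi).mono fun y hy => ?_
    have hm := h.density_mem (le_of_lt hy)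
    have hp : 0 < y ^ (-(ρ + 1)) := Real.rpow_pos_of_pos (h.pos (le_of_lt hy)) _
    rw [Real.norm_of_nonneg (by linarith)]
    exact hm.2

theorem integral_rpow (h : IsPerturbation ρ s q x₀) {x : ℝ} (hx : 0 < x) :
    ∫ y in Set.Ioi x, y ^ (-(ρ + 1)) = x ^ (-ρ) / ρ := by
  have := h.exponent_pos
  rw [integral_Ioi_rpow_of_lt (by linarith) hx, show -(ρ + 1) + 1 = -ρ by ring]
  field_simp

theorem lyapunov_mem (h : IsPerturbation ρ s q x₀) {x : ℝ} (hx : x₀ ≤ x) :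
    x ^ (-ρ) / ρ / 2 ≤ lyapunov ρ s q x₀ x ∧
      lyapunov ρ s q x₀ x ≤ 3 / 2 * (x ^ (-ρ) / ρ) := by
  have hx0 := h.pos hx
  have hi := h.integrableOn_density.mono_set (Set.Ioi_subset_Ioi hx)
  have hr : IntegrableOn (fun y : ℝ => y ^ (-(ρ + 1))) (Set.Ioi x) :=
    integrableOn_Ioi_rpow_of_lt (by linarith [h.exponent_pos]) hx0
  rw [lyapunov, max_eq_left hx, ← h.integral_rpow hx0, ← integral_const_mul,
    div_eq_mul_inv, ← integral_mul_const]
  constructor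
  · refine setIntegral_mono_on (hr.mul_const _) hi measurableSet_Ioi fun y hy => ?_
    have := (h.density_mem (hx.trans (le_of_lt hy))).1
    linarith
  · refine setIntegral_mono_on hi (hr.const_mul _) measurableSet_Ioi fun y hy => ?_
    exact (h.density_mem (hx.trans (le_of_lt hy))).2

theorem antitone_lyapunov (h : IsPerturbation ρ s q x₀) : Antitone (lyapunov ρ s q x₀) := by
  intro x y hxy
  refine setIntegral_mono_set
    (h.integrableOn_density.mono_set (Set.Ioi_subset_Ioi (le_max_right x x₀))) ?_
    (LE.le.eventuallyLE (Set.Ioi_subset_Ioi (max_le_max_right x₀ hxy)))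
  refine (ae_restrict_mem measurableSet_Ioi).mono fun z hz => ?_
  have hz' : x₀ ≤ z := (le_max_right x x₀).trans (le_of_lt hz)
  have := (h.density_mem hz').1
  have hp : 0 < z ^ (-(ρ + 1)) := Real.rpow_pos_of_pos (h.pos hz') _
  change 0 ≤ _
  linarith

theorem lyapunov_max (x : ℝ) : lyapunov ρ s q x₀ x = lyapunov ρ s q x₀ (max x x₀) := by
  simp [lyapunov]

/-- Freezing below `x₀ ≥ 1` makes the bound global, so the function may be evaluated after
arbitrarily deep downward jumps. -/
theorem lyapunov_bound (h : IsPerturbation ρ s q x₀) (x : ℝ) :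
    0 ≤ lyapunov ρ s q x₀ x ∧ lyapunov ρ s q x₀ x ≤ 2 / ρ := by
  rw [lyapunov_max]
  have hρ := h.exponent_pos
  have hm : x₀ ≤ max x x₀ := le_max_right _ _
  have hp : 0 < (max x x₀) ^ (-ρ) := Real.rpow_pos_of_pos (h.pos hm) _
  have h1 : (max x x₀) ^ (-ρ) ≤ 1 :=
    Real.rpow_le_one_of_one_le_of_nonpos (h.one_le.trans hm) (by linarith)
  have hb := h.lyapunov_mem hm
  constructor
  · exact le_trans (by positivity) hb.1
  · refine hb.2.trans ?_
    rw [← mul_div_assoc]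
    exact div_le_div_of_nonneg_right (by linarith) hρ.le

theorem hasDerivAt_lyapunov (h : IsPerturbation ρ s q x₀) {x : ℝ} (hx : x₀ < x) :
    HasDerivAt (lyapunov ρ s q x₀) (-lyapunovDensity ρ s q x) x := by
  have h1 := hasDerivAt_integral_Ioi h.integrableOn_density hx
    (h.hasDerivAt_density (h.pos hx.le)).continuousAt
  refine h1.congr_of_eventuallyEq ?_
  filter_upwards [Ioi_mem_nhds hx] with y hy
  rw [lyapunov, max_eq_left (le_of_lt hy)]

theorem abs_tail_sub_le (h : IsPerturbation ρ s q x₀) {x z : ℝ} (hx : 0 < x) (hz : x / 2 ≤ z) :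
    |rateTail q z - rateTail q x| ≤ 4 * q x * |z - x| := by
  have hx2 : 0 < x / 2 := by linarith
  have := Convex.norm_image_sub_le_of_norm_hasDerivWithin_le (𝕜 := ℝ) (s := Set.Ici (x / 2))
    (f := rateTail q) (f' := fun y => -q y) (x := x) (y := z) (C := 4 * q x)
    (fun y hy => (h.hasDerivAt_tail (hx2.trans_le hy)).hasDerivWithinAt)
    (fun y hy => by
      rw [norm_neg, Real.norm_of_nonneg (h.slow.pos y (hx2.trans_le hy)).le]
      exact h.slow.le_four_mul hx hy)
    (convex_Ici _) (by rw [Set.mem_Ici]; linarith) hz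
  simpa [Real.norm_eq_abs] using this

theorem abs_curvature_le (h : IsPerturbation ρ s q x₀) {x : ℝ} (hx : x₀ ≤ x) :
    |lyapunovCurvature ρ s q x| ≤ (3 / 2 * (ρ + 1) + 1) * (x ^ (-(ρ + 3)) * x) := by
  have hx0 := h.pos hx
  have hρ := h.exponent_pos
  have hA : 0 < x ^ (-(ρ + 3)) := Real.rpow_pos_of_pos hx0 _
  have hf := h.factor_mem hx
  have hq := h.mul_le x hx
  have hq0 := h.slow.pos x hx0
  rw [lyapunovCurvature, rpow_neg_add_two hx0, rpow_neg_add_one hx0]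
  set A := x ^ (-(ρ + 3))
  have hAx : 0 < A * x := mul_pos hA hx0
  have h1 : |(ρ + 1) * (A * x * (1 + s * rateTail q x))| ≤ 3 / 2 * (ρ + 1) * (A * x) := by
    rw [abs_of_nonneg (by apply mul_nonneg (by linarith); apply mul_nonneg hAx.le; linarith)]
    have := mul_le_mul_of_nonneg_left hf.2 (mul_pos (show 0 < ρ + 1 by linarith) hAx).le
    linarith
  have h2 : |s * (A * x ^ 2 * q x)| ≤ A * x := by
    rw [abs_mul, abs_of_nonneg (a := A * x ^ 2 * q x) (by positivity)]
    have e : A * x ^ 2 * q x = A * x * (x * q x) := by ring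
    have : A * x ^ 2 * q x ≤ A * x := by rw [e]; nlinarith
    calc |s| * (A * x ^ 2 * q x) ≤ 1 * (A * x ^ 2 * q x) :=
          mul_le_mul_of_nonneg_right h.abs_sign (by positivity)
      _ ≤ A * x := by linarith
  calc _ ≤ _ := abs_add_le _ _
    _ ≤ _ := add_le_add h1 h2
    _ = _ := by ring

/-- The Lipschitz constant of the curvature, relative to `x ^ (-(ρ + 3))`. -/
noncomputable def curvatureConst (ρ : ℝ) : ℝ :=
  (ρ + 1) * (3 / 2 * ((ρ + 2) * 2 ^ (ρ + 3)) + 4) + (4 * ((ρ + 1) * 2 ^ (ρ + 2)) + 8)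

/-- A Lipschitz bound stands in for the third derivative, since `q` need not be differentiable. The
difference is telescoped into one change at a time: power, tail, power, rate. Each has order `x ^
(-(ρ + 3))` because `q x ≤ 1 / x`; the condition `2 * x₀ ≤ x` keeps `z` above `x₀`. -/
theorem abs_curvature_sub_le (h : IsPerturbation ρ s q x₀) {x z : ℝ} (hx : 2 * x₀ ≤ x)
    (hz : x / 2 ≤ z) : |lyapunovCurvature ρ s q z - lyapunovCurvature ρ s q x| ≤
      curvatureConst ρ * x ^ (-(ρ + 3)) * |z - x| := by
  have hρ := h.exponent_pos
  have h1 := h.one_le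
  have hxx : x₀ ≤ x := by linarith
  have hx0 : 0 < x := h.pos hxx
  have hzx : x₀ ≤ z := by linarith
  have hA : 0 < x ^ (-(ρ + 3)) := Real.rpow_pos_of_pos hx0 _
  have ha := abs_rpow_neg_sub_le (α := ρ + 2) (by linarith) hx0 hz
  have hb := abs_rpow_neg_sub_le (α := ρ + 1) (by linarith) hx0 hz
  rw [show ρ + 2 + 1 = ρ + 3 by ring] at ha
  rw [show ρ + 1 + 1 = ρ + 2 by ring] at hb
  have hQ := h.abs_tail_sub_le hx0 hz
  have hqq := h.slow.abs_sub_le hx0 hz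
  have hq4 := h.slow.le_four_mul hx0 hz
  have hqx := h.mul_le x hxx
  have hqx' : q x ≤ 1 / x := by rw [le_div_iff₀ hx0]; linarith
  have hqz := h.slow.pos z (by linarith)
  have hfz := h.factor_mem hzx
  have hs := h.abs_sign
  set D := |z - x| with hD
  have hD0 : 0 ≤ D := abs_nonneg _
  have hbx : x ^ (-(ρ + 1)) = x ^ (-(ρ + 3)) * x ^ 2 := rpow_neg_add_one hx0 ρ
  have hax : x ^ (-(ρ + 2)) = x ^ (-(ρ + 3)) * x := rpow_neg_add_two hx0 ρ
  set A := x ^ (-(ρ + 3)) with hAdef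
  have t1 : |(z ^ (-(ρ + 2)) - x ^ (-(ρ + 2))) * (1 + s * rateTail q z)| ≤
      3 / 2 * ((ρ + 2) * 2 ^ (ρ + 3)) * A * D := by
    rw [abs_mul, abs_of_nonneg (a := 1 + s * rateTail q z) (by linarith)]
    calc _ ≤ ((ρ + 2) * 2 ^ (ρ + 3) * A * D) * (3 / 2) :=
          mul_le_mul ha hfz.2 (by linarith) (by positivity)
      _ = _ := by ring
  have t2 : |x ^ (-(ρ + 2)) * (s * (rateTail q z - rateTail q x))| ≤ 4 * A * D := by
    rw [abs_mul, abs_mul, hax, abs_of_nonneg (a := A * x) (by positivity)]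
    calc A * x * (|s| * |rateTail q z - rateTail q x|)
        ≤ A * x * (1 * (4 * (1 / x) * D)) := by
          refine mul_le_mul_of_nonneg_left ?_ (by positivity)
          refine mul_le_mul hs (hQ.trans ?_) (abs_nonneg _) zero_le_one
          exact mul_le_mul_of_nonneg_right (by linarith) hD0
      _ = _ := by field_simp
  have t3 : |(z ^ (-(ρ + 1)) - x ^ (-(ρ + 1))) * q z| ≤ 4 * ((ρ + 1) * 2 ^ (ρ + 2)) * A * D := by
    rw [abs_mul, abs_of_nonneg hqz.le]
    rw [hax] at hb
    calc _ ≤ ((ρ + 1) * 2 ^ (ρ + 2) * (A * x) * D) * (4 * (1 / x)) :=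
          mul_le_mul hb (by linarith) hqz.le (by positivity)
      _ = _ := by field_simp
  have t4 : |x ^ (-(ρ + 1)) * (q z - q x)| ≤ 8 * A * D := by
    rw [abs_mul, hbx, abs_of_nonneg (a := A * x ^ 2) (by positivity)]
    calc A * x ^ 2 * |q z - q x| ≤ A * x ^ 2 * (8 * (1 / x) / x * D) := by
          refine mul_le_mul_of_nonneg_left (hqq.trans ?_) (by positivity)
          gcongr
      _ = _ := by field_simp
  have e : lyapunovCurvature ρ s q z - lyapunovCurvature ρ s q x =
      (ρ + 1) * ((z ^ (-(ρ + 2)) - x ^ (-(ρ + 2))) * (1 + s * rateTail q z) +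
        x ^ (-(ρ + 2)) * (s * (rateTail q z - rateTail q x))) +
      s * ((z ^ (-(ρ + 1)) - x ^ (-(ρ + 1))) * q z + x ^ (-(ρ + 1)) * (q z - q x)) := by
    simp only [lyapunovCurvature]; ring
  rw [e]
  calc _ ≤ _ := abs_add_le _ _
    _ ≤ (ρ + 1) * (3 / 2 * ((ρ + 2) * 2 ^ (ρ + 3)) * A * D + 4 * A * D) +
        1 * (4 * ((ρ + 1) * 2 ^ (ρ + 2)) * A * D + 8 * A * D) := by
      rw [abs_mul, abs_mul, abs_of_nonneg (a := ρ + 1) (by linarith)]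
      refine add_le_add (mul_le_mul_of_nonneg_left ?_ (by linarith))
        (mul_le_mul hs ?_ (abs_nonneg _) zero_le_one)
      · exact (abs_add_le _ _).trans (add_le_add t1 t2)
      · exact (abs_add_le _ _).trans (add_le_add t3 t4)
    _ = _ := by rw [curvatureConst]; ring

theorem curvatureConst_pos (hρ : 0 < ρ) : 0 < curvatureConst ρ := by
  unfold curvatureConst; positivity

/-- The remainder of the second order expansion of the Lyapunov function. -/
noncomputable def remainder (ρ s : ℝ) (q : ℝ → ℝ) (x₀ x h : ℝ) : ℝ :=
  lyapunov ρ s q x₀ (x + h) - lyapunov ρ s q x₀ x + lyapunovDensity ρ s q x * h -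
    lyapunovCurvature ρ s q x * h ^ 2 / 2

/-- The mean value inequality is applied twice on `[x - |h|, x + |h|]`: the Lipschitz bound for the
curvature gives a quadratic error for the density (`hg`), and this gives a cubic error for the
function. -/
theorem abs_remainder_le_cube (hp : IsPerturbation ρ s q x₀) {x h : ℝ} (hx : 2 * x₀ < x)
    (hh : |h| ≤ x / 2) :
    |remainder ρ s q x₀ x h| ≤ curvatureConst ρ * x ^ (-(ρ + 3)) * |h| ^ 3 := by
  have h1 := hp.one_le
  have hx0 : 0 < x := by linarith
  set L := curvatureConst ρ * x ^ (-(ρ + 3)) with hL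
  have hL0 : 0 ≤ L :=
    mul_nonneg (curvatureConst_pos hp.exponent_pos).le (Real.rpow_nonneg hx0.le _)
  set I := Set.Icc (x - |h|) (x + |h|) with hI
  have habs := abs_nonneg h
  have hxI : x ∈ I := ⟨by linarith, by linarith⟩
  have hI2 : ∀ z ∈ I, x / 2 ≤ z ∧ |z - x| ≤ |h| := by
    intro z hz
    refine ⟨by linarith [hz.1], abs_le.2 ⟨by linarith [hz.1], by linarith [hz.2]⟩⟩
  have hg : ∀ z ∈ I, |lyapunovDensity ρ s q z - lyapunovDensity ρ s q x +
      lyapunovCurvature ρ s q x * (z - x)| ≤ L * |h| ^ 2 := by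
    intro z hz
    have := Convex.norm_image_sub_le_of_norm_hasDerivWithin_le (𝕜 := ℝ) (s := I)
      (f := fun z => lyapunovDensity ρ s q z + lyapunovCurvature ρ s q x * (z - x))
      (f' := fun z => -lyapunovCurvature ρ s q z + lyapunovCurvature ρ s q x * 1)
      (x := x) (y := z) (C := L * |h|)
      (fun y hy => ((hp.hasDerivAt_density (by linarith [(hI2 y hy).1])).add
        (((hasDerivAt_id y).sub_const x).const_mul _)).hasDerivWithinAt)
      (fun y hy => by
        have h2 := hp.abs_curvature_sub_le hx.le (hI2 y hy).1
        rw [Real.norm_eq_abs, mul_one, neg_add_eq_sub, abs_sub_comm]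
        exact h2.trans (mul_le_mul_of_nonneg_left (hI2 y hy).2 hL0))
      (convex_Icc _ _) hxI hz
    rw [Real.norm_eq_abs, Real.norm_eq_abs, sub_self, mul_zero, add_zero] at this
    calc _ = _ := by congr 1; ring
      _ ≤ _ := this
      _ ≤ L * |h| * |h| := mul_le_mul_of_nonneg_left (hI2 z hz).2 (mul_nonneg hL0 habs)
      _ = _ := by ring
  have hxh : x + h ∈ I := ⟨by linarith [neg_abs_le h], by linarith [le_abs_self h]⟩
  have := Convex.norm_image_sub_le_of_norm_hasDerivWithin_le (𝕜 := ℝ) (s := I)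
    (f := fun z => lyapunov ρ s q x₀ z + lyapunovDensity ρ s q x * (z - x) -
      lyapunovCurvature ρ s q x * ((z - x) ^ 2 / 2))
    (f' := fun z => -lyapunovDensity ρ s q z + lyapunovDensity ρ s q x * 1 -
      lyapunovCurvature ρ s q x * ((2 : ℕ) * (z - x) ^ (2 - 1) * 1 / 2))
    (x := x) (y := x + h) (C := L * |h| ^ 2)
    (fun y hy => (((hp.hasDerivAt_lyapunov (by linarith [(hI2 y hy).1])).add
      (((hasDerivAt_id y).sub_const x).const_mul _)).sub
      (((((hasDerivAt_id y).sub_const x).pow 2).div_const 2).const_mul _)).hasDerivWithinAt)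
    (fun y hy => by
      rw [Real.norm_eq_abs, ← abs_neg]
      refine le_trans (le_of_eq ?_) (hg y hy)
      congr 1
      push_cast
      ring)
    (convex_Icc _ _) hxI hxh
  rw [Real.norm_eq_abs, Real.norm_eq_abs] at this
  calc |remainder ρ s q x₀ x h| = _ := by
        rw [remainder]; congr 1; ring
    _ ≤ _ := this
    _ = _ := by rw [show x + h - x = h by ring]; ring

/-- The constant of the crude bound for the remainder. -/
noncomputable def remainderConst (ρ : ℝ) : ℝ := 8 / ρ + 3 + (3 / 2 * (ρ + 1) + 1)

/-- For a long jump no cancellation is used: the terms are bounded separately, with `x` traded for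
`2 * |h|`. Upwards the function decreases by at most its value at `x`; downwards only its global
bound is available, hence the constant `4 / ρ`. -/
theorem abs_remainder_le (hp : IsPerturbation ρ s q x₀) {x h : ℝ} (hx : x₀ ≤ x)
    (hh : x / 2 < |h|) :
    |remainder ρ s q x₀ x h| ≤
      remainderConst ρ * (x ^ (-(ρ + 3)) * x * h ^ 2) + if h < 0 then 4 / ρ else 0 := by
  have hρ := hp.exponent_pos
  have hx0 := hp.pos hx
  have hA : 0 < x ^ (-(ρ + 3)) := Real.rpow_pos_of_pos hx0 _
  have hG := hp.density_mem hx
  have hc := hp.abs_curvature_le hx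
  have hF := (hp.lyapunov_mem hx).2
  rw [rpow_neg_add_one hx0] at hG
  rw [rpow_neg_eq hx0] at hF
  set A := x ^ (-(ρ + 3)) with hAdef
  have hh2 : x ^ 2 ≤ 4 * h ^ 2 := by
    rw [← sq_abs h]; nlinarith
  have hAx : 0 ≤ A * x := by positivity
  have tG : |lyapunovDensity ρ s q x * h| ≤ 3 * (A * x * h ^ 2) := by
    have hG0 : 0 ≤ lyapunovDensity ρ s q x := le_trans (by positivity) hG.1
    rw [abs_mul, abs_of_nonneg hG0]
    calc lyapunovDensity ρ s q x * |h| ≤ 3 / 2 * (A * x ^ 2) * |h| :=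
          mul_le_mul_of_nonneg_right hG.2 (abs_nonneg _)
      _ = 3 * (A * x) * (x / 2 * |h|) := by ring
      _ ≤ 3 * (A * x) * (|h| * |h|) :=
          mul_le_mul_of_nonneg_left (mul_le_mul_of_nonneg_right hh.le (abs_nonneg _))
            (by positivity)
      _ = _ := by rw [← sq, sq_abs]; ring
  have tC : |lyapunovCurvature ρ s q x * h ^ 2 / 2| ≤
      (3 / 2 * (ρ + 1) + 1) * (A * x * h ^ 2) := by
    rw [abs_div, abs_mul, abs_of_nonneg (sq_nonneg h), abs_two]
    have h1 := mul_le_mul_of_nonneg_right hc (sq_nonneg h)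
    have h2 : 0 ≤ (3 / 2 * (ρ + 1) + 1) * (A * x) * h ^ 2 := by positivity
    linarith
  have tF : |lyapunov ρ s q x₀ (x + h) - lyapunov ρ s q x₀ x| ≤
      8 / ρ * (A * x * h ^ 2) + if h < 0 then 4 / ρ else 0 := by
    have b1 := hp.lyapunov_bound (x + h)
    have b2 := hp.lyapunov_bound x
    split_ifs with hneg
    · have : 0 ≤ 8 / ρ * (A * x * h ^ 2) := by positivity
      have e : 4 / ρ = 2 / ρ + 2 / ρ := by ring
      rw [abs_le]; constructor <;> linarith
    · have hanti := hp.antitone_lyapunov (show x ≤ x + h by linarith)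
      rw [abs_of_nonpos (by linarith), add_zero]
      calc -(lyapunov ρ s q x₀ (x + h) - lyapunov ρ s q x₀ x) ≤ lyapunov ρ s q x₀ x := by linarith
        _ ≤ 3 / 2 * (A * x ^ 3 / ρ) := hF
        _ = 3 / 2 / ρ * (A * x) * x ^ 2 := by ring
        _ ≤ 3 / 2 / ρ * (A * x) * (4 * h ^ 2) :=
            mul_le_mul_of_nonneg_left hh2 (by positivity)
        _ = 6 / ρ * (A * x * h ^ 2) := by ring
        _ ≤ 8 / ρ * (A * x * h ^ 2) := by gcongr; norm_num
  rw [remainder, remainderConst]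
  set B := A * x * h ^ 2
  calc _ ≤ |lyapunov ρ s q x₀ (x + h) - lyapunov ρ s q x₀ x + lyapunovDensity ρ s q x * h| +
        |lyapunovCurvature ρ s q x * h ^ 2 / 2| := abs_sub _ _
    _ ≤ |lyapunov ρ s q x₀ (x + h) - lyapunov ρ s q x₀ x| + |lyapunovDensity ρ s q x * h| +
        |lyapunovCurvature ρ s q x * h ^ 2 / 2| := by gcongr; exact abs_add_le _ _
    _ ≤ _ := by linarith

end IsPerturbation

end Lyapunov

/-! ### Integrable error rates from the moment conditions. -/

section Kernels

variable {Ω : Type*} [MeasurableSpace Ω] {μ : Measure Ω}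

/-- Tonelli: integrability in the level `x` is checked for each `ω` first. -/
theorem integrableOn_expectation [SFinite μ] {k : ℝ → Ω → ℝ} {H : Ω → ℝ}
    (hm : Measurable (Function.uncurry k))
    (hk0 : ∀ᵐ ω ∂μ, ∀ x, 1 < x → 0 ≤ k x ω)
    (hk : ∀ᵐ ω ∂μ, IntegrableOn (fun x => k x ω) (Set.Ioi 1) ∧
      ∫ x in Set.Ioi (1 : ℝ), k x ω ≤ H ω) (hH : Integrable H μ) :
    IntegrableOn (fun x => ∫ ω, k x ω ∂μ) (Set.Ioi 1) := by
  have hprod : Integrable (Function.uncurry k) ((volume.restrict (Set.Ioi 1)).prod μ) := by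
    rw [integrable_prod_iff' hm.aestronglyMeasurable]
    refine ⟨hk.mono fun ω h => h.1, ?_⟩
    have hsm : StronglyMeasurable fun ω => ∫ x in Set.Ioi (1 : ℝ), ‖Function.uncurry k (x, ω)‖ :=
      hm.norm.stronglyMeasurable.integral_prod_left'
    refine hH.mono' hsm.aestronglyMeasurable ?_
    filter_upwards [hk, hk0] with ω h1 h2
    rw [Real.norm_of_nonneg (integral_nonneg fun _ => norm_nonneg _)]
    refine le_trans (le_of_eq ?_) h1.2
    refine setIntegral_congr_fun measurableSet_Ioi fun x hx => ?_
    exact Real.norm_of_nonneg (h2 x hx)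
  exact hprod.integral_prod_left

/-- The error caused by upward jumps bounded by `y`, seen from level `x`. -/
noncomputable def upKernel (x y : ℝ) : ℝ := y ^ 2 / x * min 1 (2 * y / x)

/-- The error caused by a downward jump of size `y` that exceeds half the level `x`. -/
noncomputable def downKernel (ρ x y : ℝ) : ℝ := if x < 2 * y then y ^ (ρ + 1) else 0

theorem upKernel_nonneg {x y : ℝ} (hx : 0 < x) (hy : 0 ≤ y) : 0 ≤ upKernel x y := by
  unfold upKernel; positivity

theorem upKernel_anti {x z y : ℝ} (hx : 0 < x) (hxz : x ≤ z) (hy : 0 ≤ y) :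
    upKernel z y ≤ upKernel x y := by
  have hz := hx.trans_le hxz
  unfold upKernel
  refine mul_le_mul (by gcongr) (min_le_min le_rfl (by gcongr)) (by positivity) (by positivity)

theorem upKernel_le {x y : ℝ} (hx : 1 ≤ x) : upKernel x y ≤ y ^ 2 := by
  have hx0 : 0 < x := by linarith
  have h1 : y ^ 2 / x ≤ y ^ 2 := div_le_self (sq_nonneg y) hx
  calc upKernel x y ≤ y ^ 2 / x * 1 :=
        mul_le_mul_of_nonneg_left (min_le_left _ _) (by positivity)
    _ ≤ y ^ 2 := by linarith

theorem downKernel_nonneg {ρ x y : ℝ} (hy : 0 ≤ y) : 0 ≤ downKernel ρ x y := by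
  unfold downKernel; split_ifs <;> positivity

theorem downKernel_anti {ρ x z y : ℝ} (hxz : x ≤ z) (hy : 0 ≤ y) :
    downKernel ρ z y ≤ downKernel ρ x y := by
  unfold downKernel
  split_ifs with h1 h2
  · exact le_rfl
  · exact absurd (hxz.trans_lt h1) h2
  · positivity
  · exact le_rfl

theorem measurable_upKernel : Measurable (Function.uncurry upKernel) := by
  unfold upKernel Function.uncurry; fun_prop

theorem measurable_downKernel (ρ : ℝ) : Measurable (Function.uncurry (downKernel ρ)) := by
  unfold downKernel Function.uncurry
  refine Measurable.ite (measurableSet_lt measurable_fst (by fun_prop)) ?_ measurable_const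
  exact measurable_snd.pow_const _

/-- The source of the condition on `τ² log(1+τ)`: up to level `1 + 2 * y` the kernel is at most `y²
/ x`, which produces the logarithm; beyond it decays like `y³ / x²`. -/
theorem integrableOn_upKernel {y : ℝ} (hy : 0 ≤ y) :
    IntegrableOn (fun x => upKernel x y) (Set.Ioi 1) ∧
      ∫ x in Set.Ioi (1 : ℝ), upKernel x y ≤ y ^ 2 * Real.log (1 + 2 * y) + 2 * y ^ 2 := by
  set b : ℝ := 1 + 2 * y with hb
  have hb1 : 1 ≤ b := by linarith
  have hb0 : 0 < b := by linarith
  have hm : ∀ s, AEStronglyMeasurable (fun x => upKernel x y) (volume.restrict s) := fun s =>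
    (measurable_upKernel.comp (measurable_id.prodMk measurable_const)).aestronglyMeasurable
  have hi1 : IntegrableOn (fun x : ℝ => y ^ 2 * x⁻¹) (Set.Ioc 1 b) := by
    have : IntervalIntegrable (fun x : ℝ => x⁻¹) volume 1 b :=
      intervalIntegrable_inv_iff.2 (Or.inr (by
        rw [Set.uIcc_of_le hb1]; intro h; linarith [h.1]))
    exact ((intervalIntegrable_iff_integrableOn_Ioc_of_le hb1).1 this).const_mul _
  have hi2 : IntegrableOn (fun x : ℝ => 2 * y ^ 3 * x ^ (-2 : ℝ)) (Set.Ioi b) :=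
    (integrableOn_Ioi_rpow_of_lt (by norm_num) hb0).const_mul _
  have hle1 : ∀ x ∈ Set.Ioc 1 b, upKernel x y ≤ y ^ 2 * x⁻¹ := by
    intro x hx
    have hx0 : 0 < x := by linarith [hx.1]
    rw [← div_eq_mul_inv]
    exact mul_le_of_le_one_right (by positivity) (min_le_left _ _)
  have hle2 : ∀ x ∈ Set.Ioi b, upKernel x y ≤ 2 * y ^ 3 * x ^ (-2 : ℝ) := by
    intro x hx
    have hx0 : 0 < x := hb0.trans hx
    calc upKernel x y ≤ y ^ 2 / x * (2 * y / x) :=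
          mul_le_mul_of_nonneg_left (min_le_right _ _) (by positivity)
      _ = 2 * y ^ 3 * x ^ (-2 : ℝ) := by
          rw [Real.rpow_neg hx0.le, Real.rpow_two]; field_simp
  have hk1 : IntegrableOn (fun x => upKernel x y) (Set.Ioc 1 b) :=
    hi1.mono' (hm _) ((ae_restrict_mem measurableSet_Ioc).mono fun x hx => by
      rw [Real.norm_of_nonneg (upKernel_nonneg (by linarith [hx.1]) hy)]; exact hle1 x hx)
  have hk2 : IntegrableOn (fun x => upKernel x y) (Set.Ioi b) :=
    hi2.mono' (hm _) ((ae_restrict_mem measurableSet_Ioi).mono fun x hx => by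
      rw [Real.norm_of_nonneg (upKernel_nonneg (hb0.trans hx) hy)]; exact hle2 x hx)
  rw [← Set.Ioc_union_Ioi_eq_Ioi hb1]
  refine ⟨hk1.union hk2, ?_⟩
  rw [setIntegral_union (Set.Ioc_disjoint_Ioi le_rfl) measurableSet_Ioi hk1 hk2]
  refine add_le_add ?_ ?_
  · refine (setIntegral_mono_on hk1 hi1 measurableSet_Ioc hle1).trans (le_of_eq ?_)
    rw [integral_const_mul, ← intervalIntegral.integral_of_le hb1,
      integral_inv_of_pos one_pos hb0, div_one]
  · refine (setIntegral_mono_on hk2 hi2 measurableSet_Ioi hle2).trans ?_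
    rw [integral_const_mul, integral_Ioi_rpow_of_lt (by norm_num) hb0,
      show (-2 : ℝ) + 1 = -1 by norm_num, Real.rpow_neg_one]
    have : y * b⁻¹ ≤ 1 := by rw [← div_eq_mul_inv, div_le_one hb0]; linarith
    calc 2 * y ^ 3 * (-b⁻¹ / -1) = 2 * y ^ 2 * (y * b⁻¹) := by ring
      _ ≤ 2 * y ^ 2 * 1 := mul_le_mul_of_nonneg_left this (by positivity)
      _ = _ := by ring

/-- The source of the condition on `ξ^(ρ+2)`: a constant `y^(ρ+1)` over a range of levels of length
at most `2 * y`. -/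
theorem integrableOn_downKernel {ρ y : ℝ} (hy : 0 ≤ y) (hρ : 0 < ρ) :
    IntegrableOn (fun x => downKernel ρ x y) (Set.Ioi 1) ∧
      ∫ x in Set.Ioi (1 : ℝ), downKernel ρ x y ≤ 2 * y ^ (ρ + 2) := by
  have e : (fun x => downKernel ρ x y) = (Set.Iio (2 * y)).indicator fun _ => y ^ (ρ + 1) := by
    funext x; simp [downKernel, Set.indicator]
  rw [e]
  have hc : IntegrableOn (fun _ : ℝ => y ^ (ρ + 1)) (Set.Ioi 1 ∩ Set.Iio (2 * y)) :=
    integrableOn_const (by rw [Set.Ioi_inter_Iio]; simp)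
  constructor
  · rw [IntegrableOn, integrable_indicator_iff measurableSet_Iio, IntegrableOn,
      Measure.restrict_restrict measurableSet_Iio, Set.inter_comm]
    exact hc
  · rw [setIntegral_indicator measurableSet_Iio, setIntegral_const, Set.Ioi_inter_Iio,
      Measure.real, Real.volume_Ioo, smul_eq_mul, ENNReal.toReal_ofReal',
      show y ^ (ρ + 2) = y ^ (ρ + 1) * y by
        rw [show ρ + 2 = ρ + 1 + 1 by ring, Real.rpow_add_one' hy (by linarith)]]
    have hm : max (2 * y - 1) 0 ≤ 2 * y := max_le (by linarith) (by linarith)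
    calc _ ≤ 2 * y * y ^ (ρ + 1) := mul_le_mul_of_nonneg_right hm (by positivity)
      _ = _ := by ring

/-- The total error rate of the drift of the Lyapunov function. -/
noncomputable def errorRate (μ : Measure Ω) (X Y : Ω → ℝ) (p : ℝ → ℝ) (ρ r x : ℝ) : ℝ :=
  p x + x ^ (-(1 + r)) + ((∫ ω, upKernel x (X ω) ∂μ) + ∫ ω, downKernel ρ x (Y ω) ∂μ)

variable {X Y : Ω → ℝ} {p : ℝ → ℝ} {ρ r : ℝ}

theorem integrable_upKernel (hXm : Measurable X) (hX0 : ∀ᵐ ω ∂μ, 0 ≤ X ω)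
    (hX2 : Integrable (fun ω => X ω ^ 2) μ) {x : ℝ} (hx : 1 ≤ x) :
    Integrable (fun ω => upKernel x (X ω)) μ := by
  refine hX2.mono'
    (measurable_upKernel.comp (measurable_const.prodMk hXm)).aestronglyMeasurable ?_
  filter_upwards [hX0] with ω h
  rw [Real.norm_of_nonneg (upKernel_nonneg (by linarith) h)]
  exact upKernel_le hx

variable [IsProbabilityMeasure μ]

theorem integrable_downKernel (hYm : Measurable Y) (hY0 : ∀ᵐ ω ∂μ, 0 ≤ Y ω) (hρ : 0 < ρ)
    (hYρ : Integrable (fun ω => Y ω ^ (ρ + 2)) μ) (x : ℝ) :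
    Integrable (fun ω => downKernel ρ x (Y ω)) μ := by
  have hm := ((measurable_downKernel ρ).comp ((measurable_const (a := x)).prodMk hYm))
  refine (hYρ.add (integrable_const (1 : ℝ))).mono' hm.aestronglyMeasurable ?_
  filter_upwards [hY0] with ω h
  rw [Real.norm_of_nonneg (downKernel_nonneg h)]
  have h1 : Y ω ^ (ρ + 1) ≤ Y ω ^ (ρ + 2) + 1 := by
    rcases le_total (Y ω) 1 with h1 | h1
    · have := Real.rpow_le_one h h1 (show 0 ≤ ρ + 1 by linarith)
      have : 0 ≤ Y ω ^ (ρ + 2) := by positivity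
      linarith
    · have := Real.rpow_le_rpow_of_exponent_le h1 (show ρ + 1 ≤ ρ + 2 by linarith)
      linarith
  have h2 : 0 ≤ Y ω ^ (ρ + 1) := by positivity
  change downKernel ρ x (Y ω) ≤ Y ω ^ (ρ + 2) + 1
  unfold downKernel
  split_ifs <;> linarith

theorem exists_isSlowRate_errorRate (hXm : Measurable X) (hYm : Measurable Y)
    (hX0 : ∀ᵐ ω ∂μ, 0 ≤ X ω) (hY0 : ∀ᵐ ω ∂μ, 0 ≤ Y ω)
    (hX2 : Integrable (fun ω => X ω ^ 2) μ)
    (hXlog : Integrable (fun ω => X ω ^ 2 * Real.log (1 + 2 * X ω)) μ)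
    (hρ : 0 < ρ) (hYρ : Integrable (fun ω => Y ω ^ (ρ + 2)) μ) (hr : 0 < r)
    (hp_anti : AntitoneOn p (Set.Ioi 1)) (hp_int : IntegrableAtFilter p atTop)
    (hp0 : ∀ x, 1 < x → 0 ≤ p x) :
    ∃ q, IsSlowRate q ∧ ∀ x, 2 ≤ x → errorRate μ X Y p ρ r x ≤ q x := by
  have hI : Set.Ioi (1 : ℝ) ∈ (atTop : Filter ℝ) := Ioi_mem_atTop 1
  refine exists_isSlowRate ?_ ?_ ?_
  · intro x hx z hz hxz
    have hx0 : (0 : ℝ) < x := lt_trans one_pos hx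
    refine add_le_add (add_le_add (hp_anti hx hz hxz) ?_) (add_le_add ?_ ?_)
    · exact Real.rpow_le_rpow_of_nonpos hx0 hxz (by linarith)
    · refine integral_mono_ae (integrable_upKernel hXm hX0 hX2 (le_of_lt hz))
        (integrable_upKernel hXm hX0 hX2 (le_of_lt hx)) ?_
      filter_upwards [hX0] with ω h
      exact upKernel_anti hx0 hxz h
    · refine integral_mono_ae (integrable_downKernel hYm hY0 hρ hYρ z)
        (integrable_downKernel hYm hY0 hρ hYρ x) ?_
      filter_upwards [hY0] with ω h
      exact downKernel_anti hxz h
  · intro x hx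
    have h1 : 0 < x ^ (-(1 + r)) := Real.rpow_pos_of_pos (by linarith) _
    have h2 : 0 ≤ ∫ ω, upKernel x (X ω) ∂μ := integral_nonneg_of_ae (by
      filter_upwards [hX0] with ω h
      exact upKernel_nonneg (by linarith) h)
    have h3 : 0 ≤ ∫ ω, downKernel ρ x (Y ω) ∂μ := integral_nonneg_of_ae (by
      filter_upwards [hY0] with ω h
      exact downKernel_nonneg h)
    have := hp0 x hx
    unfold errorRate
    linarith
  · refine (hp_int.add ?_).add (IntegrableAtFilter.add ?_ ?_)
    · exact ⟨_, hI, integrableOn_Ioi_rpow_of_lt (by linarith) one_pos⟩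
    · refine ⟨_, hI, integrableOn_expectation (k := fun x ω => upKernel x (X ω))
        (H := fun ω => X ω ^ 2 * Real.log (1 + 2 * X ω) + 2 * X ω ^ 2) ?_ ?_ ?_
        (hXlog.add (hX2.const_mul 2))⟩
      · exact measurable_upKernel.comp (measurable_fst.prodMk (hXm.comp measurable_snd))
      · exact hX0.mono fun ω h x hx => upKernel_nonneg (by linarith) h
      · exact hX0.mono fun ω h => integrableOn_upKernel h
    · refine ⟨_, hI, integrableOn_expectation (k := fun x ω => downKernel ρ x (Y ω))
        (H := fun ω => 2 * Y ω ^ (ρ + 2)) ?_ ?_ ?_ (hYρ.const_mul 2)⟩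
      · exact (measurable_downKernel ρ).comp (measurable_fst.prodMk (hYm.comp measurable_snd))
      · exact hY0.mono fun ω h x hx => downKernel_nonneg h
      · exact hY0.mono fun ω h => integrableOn_downKernel h hρ

/-- The constant of the pointwise bound for the remainder. -/
noncomputable def jumpConst (ρ : ℝ) : ℝ :=
  IsPerturbation.curvatureConst ρ + 2 * IsPerturbation.remainderConst ρ + 4 / ρ * 2 ^ (ρ + 1)

/-- Here `y` bounds the jump upwards and `z` downwards. The cases are the sign of `h` and whether
`|h|` exceeds `x / 2`; the cubic bound serves short jumps and the crude one long jumps. -/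
theorem IsPerturbation.abs_remainder_le_kernels {s x₀ x h y z : ℝ} {q : ℝ → ℝ}
    (hp : IsPerturbation ρ s q x₀) (hx : 2 * x₀ < x) (hr : 0 < r) (hr1 : r ≤ 1)
    (hy : 0 ≤ y) (hz : 0 ≤ z) (hhy : h ≤ y) (hhz : -z ≤ h) :
    |IsPerturbation.remainder ρ s q x₀ x h| ≤ jumpConst ρ * x ^ (-(ρ + 1)) *
      (upKernel x y + x ^ (-(1 + r)) * z ^ (2 + r) + downKernel ρ x z) := by
  have h1 := hp.one_le
  have hρ := hp.exponent_pos
  have hx0 : 0 < x := by linarith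
  have hu := upKernel_nonneg hx0 hy
  have hd := downKernel_nonneg (ρ := ρ) (x := x) hz
  have hA : 0 < x ^ (-(ρ + 3)) := Real.rpow_pos_of_pos hx0 _
  have hc1 := IsPerturbation.curvatureConst_pos hρ
  have hc2 : 0 < IsPerturbation.remainderConst ρ := by
    unfold IsPerturbation.remainderConst; positivity
  have hc3 : 0 < 4 / ρ * (2 : ℝ) ^ (ρ + 1) := by positivity
  have hm : 0 ≤ x ^ (-(1 + r)) * z ^ (2 + r) := by positivity
  have hB : x ^ (-(ρ + 1)) = x ^ (-(ρ + 3)) * x ^ 2 := rpow_neg_add_one hx0 ρ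
  have hx1r : x ^ 2 * x ^ (-(1 + r)) = x ^ (1 - r) := by
    rw [← Real.rpow_natCast, ← Real.rpow_add hx0]; congr 1; push_cast; ring
  set B := x ^ (-(ρ + 1)) with hBdef
  have hB0 : 0 < B := Real.rpow_pos_of_pos hx0 _
  set U := upKernel x y with hU
  set M := x ^ (-(1 + r)) * z ^ (2 + r) with hM
  set E := downKernel ρ x z with hE
  have main : |IsPerturbation.remainder ρ s q x₀ x h| ≤
      IsPerturbation.curvatureConst ρ * B * (U + M) ∨
      |IsPerturbation.remainder ρ s q x₀ x h| ≤
      2 * IsPerturbation.remainderConst ρ * B * (U + M) + 4 / ρ * 2 ^ (ρ + 1) * B * E := by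
    rcases le_or_gt |h| (x / 2) with hh | hh
    · left
      refine (hp.abs_remainder_le_cube hx hh).trans ?_
      have key : |h| ^ 3 ≤ x ^ 2 * (U + M) := by
        rcases le_or_gt 0 h with hpos | hneg
        · have hU' : x ^ 2 * U = min (x * y ^ 2) (2 * y ^ 3) := by
            rw [hU, upKernel, ← mul_assoc, mul_min_of_nonneg _ _ (by positivity)]
            congr 1 <;> field_simp
          rw [abs_of_nonneg hpos] at hh ⊢
          have h2 : h ^ 2 ≤ y ^ 2 := by gcongr
          have h3 : h ^ 3 ≤ x ^ 2 * U := by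
            rw [hU']
            refine le_min ?_ ?_
            · nlinarith [sq_nonneg y, sq_nonneg h]
            · have : h ^ 3 ≤ y ^ 3 := by gcongr
              have : 0 ≤ y ^ 3 := by positivity
              linarith
          have : 0 ≤ x ^ 2 * M := by positivity
          linarith
        · rw [abs_of_neg hneg] at hh ⊢
          have hh0 : 0 < -h := by linarith
          -- Interpolation: only `2 + r` moments of the claim are spent, and the remaining power,
          -- nonnegative since `r ≤ 1`, is absorbed by `x`.
          have e : (-h) ^ 3 = (-h) ^ (1 - r) * (-h) ^ (2 + r) := by
            rw [← Real.rpow_add hh0, show 1 - r + (2 + r) = ((3 : ℕ) : ℝ) by push_cast; ring,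
              Real.rpow_natCast]
          have h3 : (-h) ^ 3 ≤ x ^ 2 * M := by
            rw [hM, ← mul_assoc, hx1r, e]
            refine mul_le_mul ?_ ?_ (by positivity) (by positivity)
            · exact Real.rpow_le_rpow hh0.le (by linarith) (by linarith)
            · exact Real.rpow_le_rpow hh0.le (by linarith) (by linarith)
          have : 0 ≤ x ^ 2 * U := by positivity
          linarith
      calc _ ≤ IsPerturbation.curvatureConst ρ * x ^ (-(ρ + 3)) * (x ^ 2 * (U + M)) :=
            mul_le_mul_of_nonneg_left key (by positivity)
        _ = _ := by rw [hB]; ring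
    · right
      refine (hp.abs_remainder_le (by linarith) hh).trans ?_
      have key : x * h ^ 2 ≤ x ^ 2 * (2 * (U + M)) := by
        rcases le_or_gt 0 h with hpos | hneg
        · rw [abs_of_nonneg hpos] at hh
          have hU' : U = y ^ 2 / x := by
            rw [hU, upKernel, min_eq_left, mul_one]
            rw [le_div_iff₀ hx0]; linarith
          have h3 : x * h ^ 2 ≤ x ^ 2 * U := by
            rw [hU', show x ^ 2 * (y ^ 2 / x) = x * y ^ 2 by field_simp]
            gcongr
          have : 0 ≤ x ^ 2 * M := by positivity
          have : 0 ≤ x ^ 2 * U := by positivity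
          linarith
        · rw [abs_of_neg hneg] at hh
          have hz0 : 0 < z := by linarith
          -- Since `z > x / 2`, this factor can be inserted for free; it trades `r` powers of `z`
          -- for decay in `x`.
          have h4 : 1 ≤ (2 * z / x) ^ r := by
            refine Real.one_le_rpow ?_ hr.le
            rw [le_div_iff₀ hx0]; linarith
          have h5 : (2 : ℝ) ^ r ≤ 2 := by
            calc (2 : ℝ) ^ r ≤ 2 ^ (1 : ℝ) :=
                  Real.rpow_le_rpow_of_exponent_le (by norm_num) hr1
              _ = 2 := Real.rpow_one 2
          have h6 : x * h ^ 2 ≤ x * z ^ 2 := by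
            have : h ^ 2 ≤ z ^ 2 := by nlinarith
            exact mul_le_mul_of_nonneg_left this hx0.le
          have h7 : x * z ^ 2 * (2 * z / x) ^ r = 2 ^ r * (x ^ 2 * M) := by
            rw [hM, ← mul_assoc (x ^ 2), hx1r, Real.div_rpow (by positivity) hx0.le,
              Real.mul_rpow (by norm_num) hz, Real.rpow_sub hx0, Real.rpow_one,
              Real.rpow_add hz0, Real.rpow_two]
            ring
          have h8 : x * z ^ 2 ≤ x * z ^ 2 * (2 * z / x) ^ r :=
            le_mul_of_one_le_right (by positivity) h4
          have hM0 : 0 ≤ x ^ 2 * M := by positivity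
          have : 2 ^ r * (x ^ 2 * M) ≤ 2 * (x ^ 2 * M) := mul_le_mul_of_nonneg_right h5 hM0
          have : 0 ≤ x ^ 2 * U := by positivity
          linarith
      -- The constant loss is multiplied by `(2 * z / x) ^ (ρ + 1) ≥ 1`, which extracts the common
      -- factor `x ^ (-(ρ + 1))`.
      have key2 : (if h < 0 then 4 / ρ else 0) ≤ 4 / ρ * 2 ^ (ρ + 1) * B * E := by
        split_ifs with hneg
        · rw [abs_of_neg hneg] at hh
          have hzx : x < 2 * z := by linarith
          have hE' : E = z ^ (ρ + 1) := by rw [hE, downKernel, if_pos hzx]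
          have e : (2 : ℝ) ^ (ρ + 1) * B * E = (2 * z / x) ^ (ρ + 1) := by
            rw [hE', hBdef, Real.div_rpow (by positivity) hx0.le, Real.mul_rpow (by norm_num) hz,
              Real.rpow_neg hx0.le]
            field_simp
          rw [mul_assoc, mul_assoc, ← mul_assoc ((2 : ℝ) ^ (ρ + 1)), e]
          refine le_mul_of_one_le_right (by positivity) (Real.one_le_rpow ?_ (by linarith))
          rw [le_div_iff₀ hx0]; linarith
        · positivity
      refine add_le_add ?_ key2
      calc _ = IsPerturbation.remainderConst ρ * x ^ (-(ρ + 3)) * (x * h ^ 2) := by ring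
        _ ≤ IsPerturbation.remainderConst ρ * x ^ (-(ρ + 3)) * (x ^ 2 * (2 * (U + M))) :=
            mul_le_mul_of_nonneg_left key (by positivity)
        _ = _ := by rw [hB]; ring
  have p1 : 0 ≤ IsPerturbation.curvatureConst ρ * B * (U + M) := by positivity
  have p2 : 0 ≤ 2 * IsPerturbation.remainderConst ρ * B * (U + M) := by positivity
  have p3 : 0 ≤ 4 / ρ * 2 ^ (ρ + 1) * B * E := by positivity
  have p4 : 0 ≤ 4 / ρ * 2 ^ (ρ + 1) * B * (U + M) := by positivity
  have p5 : 0 ≤ IsPerturbation.curvatureConst ρ * B * E := by positivity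
  have p6 : 0 ≤ 2 * IsPerturbation.remainderConst ρ * B * E := by positivity
  have e : jumpConst ρ * B * (U + M + E) = IsPerturbation.curvatureConst ρ * B * (U + M) +
      2 * IsPerturbation.remainderConst ρ * B * (U + M) + 4 / ρ * 2 ^ (ρ + 1) * B * E +
      4 / ρ * 2 ^ (ρ + 1) * B * (U + M) + IsPerturbation.curvatureConst ρ * B * E +
      2 * IsPerturbation.remainderConst ρ * B * E := by
    unfold jumpConst; ring
  rw [e]
  rcases main with h | h <;> linarith

end Kernels

/-! ### First and second moments of one step of the chain. -/

section Moments

variable {v p : ℝ → ℝ} {φ : ℝ → ℝ → ℝ} {C c θ : ℝ}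

/-- On `[0, t]` the flow stays between `x` and `x + C * t`, so `p` is at most `p x` and `θ / φ`
differs from `θ / x` by at most `θ C t / x²`. The sharp estimate serves the mean, the crude one the
second moment. -/
theorem IsFlow.abs_sub_le (hφ : IsFlow v φ) (h0 : ∀ y, 0 ≤ v y) (hC : ∀ y, v y ≤ C)
    (hp_anti : AntitoneOn p (Set.Ioi 1)) (hrate : ∀ z, 1 < z → |v z - c - θ / z| ≤ p z)
    (hθ : 0 < θ) {x t : ℝ} (hx : 1 < x) (ht : 0 ≤ t) :
    |φ x t - x - (c + θ / x) * t| ≤ p x * t + θ * C * t ^ 2 / x ^ 2 ∧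
      |φ x t - x - c * t| ≤ (p x + θ / x) * t := by
  have hx0 : 0 < x := by linarith
  have hpath := hφ.path x hx0.le
  obtain ⟨hint, heq⟩ := hpath t ht
  have hdisp : ∀ d : ℝ, φ x t - x - d * t = ∫ s in (0 : ℝ)..t, (v (φ x s) - d) := by
    intro d
    rw [intervalIntegral.integral_sub hint intervalIntegrable_const, heq]
    simp
    ring
  have hV : ∀ s ∈ Set.uIoc 0 t, x ≤ φ x s ∧ φ x s - x ≤ C * t := by
    intro s hs
    rw [Set.uIoc_of_le ht] at hs
    have h1 := hφ.sub_mem_Icc h0 hC hx0.le hs.1.le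
    have hC0 : 0 ≤ C := (h0 0).trans (hC 0)
    have : C * s ≤ C * t := mul_le_mul_of_nonneg_left hs.2 hC0
    exact ⟨by linarith [h1.1], by linarith [h1.2]⟩
  have hb : ∀ s ∈ Set.uIoc 0 t, |v (φ x s) - c - θ / φ x s| ≤ p x := by
    intro s hs
    have h1 := (hV s hs).1
    exact (hrate _ (hx.trans_le h1)).trans (hp_anti hx (hx.trans_le h1) h1)
  constructor
  · rw [hdisp]
    have := intervalIntegral.norm_integral_le_of_norm_le_const (a := 0) (b := t)
      (f := fun s => v (φ x s) - (c + θ / x)) (C := p x + θ * C * t / x ^ 2) (fun s hs => by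
        obtain ⟨h1, h2⟩ := hV s hs
        have hVp : 0 < φ x s := hx0.trans_le h1
        have h3 := hb s hs
        have h4 : |θ / φ x s - θ / x| ≤ θ * C * t / x ^ 2 := by
          have e : θ / φ x s - θ / x = -(θ * (φ x s - x) / (x * φ x s)) := by
            field_simp
            ring
          have hn : 0 ≤ θ * (φ x s - x) :=
            mul_nonneg hθ.le (by linarith)
          rw [e, abs_neg, abs_of_nonneg (div_nonneg hn (by positivity))]
          refine div_le_div₀ ?_ ?_ (by positivity) ?_
          · have := h2.trans' (sub_nonneg.2 h1)
            rw [mul_assoc]; exact mul_nonneg hθ.le this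
          · rw [mul_assoc]; exact mul_le_mul_of_nonneg_left h2 hθ.le
          · rw [sq]; exact mul_le_mul_of_nonneg_left h1 hx0.le
        rw [Real.norm_eq_abs, show v (φ x s) - (c + θ / x) =
          (v (φ x s) - c - θ / φ x s) + (θ / φ x s - θ / x) by ring]
        exact (abs_add_le _ _).trans (add_le_add h3 h4))
    rw [Real.norm_eq_abs, sub_zero, abs_of_nonneg ht] at this
    refine this.trans (le_of_eq ?_)
    ring
  · rw [hdisp]
    have := intervalIntegral.norm_integral_le_of_norm_le_const (a := 0) (b := t)
      (f := fun s => v (φ x s) - c) (C := p x + θ / x) (fun s hs => by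
        obtain ⟨h1, h2⟩ := hV s hs
        have hVp : 0 < φ x s := hx0.trans_le h1
        have h4 : |θ / φ x s| ≤ θ / x := by
          rw [abs_of_nonneg (by positivity)]
          exact div_le_div_of_nonneg_left hθ.le hx0 h1
        rw [Real.norm_eq_abs, show v (φ x s) - c =
          (v (φ x s) - c - θ / φ x s) + θ / φ x s by ring]
        exact (abs_add_le _ _).trans (add_le_add (hb s hs) h4))
    rwa [Real.norm_eq_abs, sub_zero, abs_of_nonneg ht] at this

variable {Ω : Type*} [MeasurableSpace Ω] {μ : Measure Ω} {S T : Ω → ℝ}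

/-- The increment of the reserve over one claim cycle that starts from the level `x`. -/
noncomputable def increment (φ : ℝ → ℝ → ℝ) (S T : Ω → ℝ) (x : ℝ) (ω : Ω) : ℝ :=
  φ x (T ω) - S ω - x

theorem measurable_increment (hφ : Measurable (Function.uncurry φ)) (hS : Measurable S)
    (hT : Measurable T) (x : ℝ) : Measurable (increment φ S T x) :=
  ((hφ.comp (measurable_const.prodMk hT)).sub hS).sub_const x

theorem memLp_increment (hφ : IsFlow v φ) (h0 : ∀ y, 0 ≤ v y) (hC : ∀ y, v y ≤ C)
    (hTm : Measurable T) (hT0 : ∀ᵐ ω ∂μ, 0 ≤ T ω) (hS2 : MemLp S 2 μ)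
    (hT2 : MemLp T 2 μ) {x : ℝ} (hx : 0 ≤ x) : MemLp (increment φ S T x) 2 μ := by
  have h1 : MemLp (fun ω => φ x (T ω) - x) 2 μ := by
    refine (hT2.const_mul C).of_le
      ((hφ.measurable.comp (measurable_const.prodMk hTm)).sub_const x).aestronglyMeasurable ?_
    filter_upwards [hT0] with ω h
    have := hφ.sub_mem_Icc h0 hC hx h
    rw [Real.norm_of_nonneg this.1]
    exact this.2.trans (le_abs_self _)
  refine (h1.sub hS2).ae_eq (Eventually.of_forall fun ω => ?_)
  simp only [increment, Pi.sub_apply]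
  ring

/-- The rate `p x + θ / x` need not be integrable; it is enough here because the second moment
enters the drift with an additional factor `1 / x`. -/
theorem abs_integral_increment_sq_sub_le (hφ : IsFlow v φ) (h0 : ∀ y, 0 ≤ v y)
    (hC : ∀ y, v y ≤ C)
    (hp_anti : AntitoneOn p (Set.Ioi 1)) (hrate : ∀ z, 1 < z → |v z - c - θ / z| ≤ p z)
    (hθ : 0 < θ) (hTm : Measurable T) (hT0 : ∀ᵐ ω ∂μ, 0 ≤ T ω)
    (hS2 : MemLp S 2 μ) (hT2 : MemLp T 2 μ)
    {x : ℝ} (hx : 1 < x) :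
    |(∫ ω, increment φ S T x ω ^ 2 ∂μ) - ∫ ω, (c * T ω - S ω) ^ 2 ∂μ| ≤
      2 * (p x + θ / x) * (∫ ω, |c * T ω - S ω| * T ω ∂μ) +
        (p x + θ / x) ^ 2 * ∫ ω, T ω ^ 2 ∂μ := by
  have hΔ := (memLp_increment hφ h0 hC hTm hT0 hS2 hT2 (by linarith : 0 ≤ x)).integrable_sq
  have hW : MemLp (fun ω => c * T ω - S ω) 2 μ := (hT2.const_mul c).sub hS2
  have hWT : Integrable (fun ω => |c * T ω - S ω| * T ω) μ := hW.abs.integrable_mul hT2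
  have hTsq := hT2.integrable_sq
  rw [← integral_sub hΔ hW.integrable_sq, ← Real.norm_eq_abs]
  refine (norm_integral_le_of_norm_le
    (g := fun ω => 2 * (p x + θ / x) * (|c * T ω - S ω| * T ω) + (p x + θ / x) ^ 2 * T ω ^ 2)
    ((hWT.const_mul _).add (hTsq.const_mul _)) ?_).trans (le_of_eq ?_)
  · filter_upwards [hT0] with ω h
    have hδ := (hφ.abs_sub_le h0 hC hp_anti hrate hθ hx h).2
    set δ := φ x (T ω) - x - c * T ω with hδdef
    have e : increment φ S T x ω ^ 2 - (c * T ω - S ω) ^ 2 =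
        2 * ((c * T ω - S ω) * δ) + δ ^ 2 := by
      unfold increment; rw [hδdef]; ring
    rw [e, Real.norm_eq_abs]
    have h1 : |(c * T ω - S ω) * δ| ≤ |c * T ω - S ω| * ((p x + θ / x) * T ω) := by
      rw [abs_mul]; exact mul_le_mul_of_nonneg_left hδ (abs_nonneg _)
    have h2 : δ ^ 2 ≤ ((p x + θ / x) * T ω) ^ 2 := by
      rw [← sq_abs δ]; exact pow_le_pow_left₀ (abs_nonneg _) hδ 2
    calc _ ≤ |2 * ((c * T ω - S ω) * δ)| + |δ ^ 2| := abs_add_le _ _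
      _ = 2 * |(c * T ω - S ω) * δ| + δ ^ 2 := by
        rw [abs_mul, abs_two, abs_of_nonneg (sq_nonneg δ)]
      _ ≤ 2 * (|c * T ω - S ω| * ((p x + θ / x) * T ω)) + ((p x + θ / x) * T ω) ^ 2 := by
        linarith
      _ = _ := by ring
  · rw [integral_add (hWT.const_mul _) (hTsq.const_mul _), integral_const_mul,
      integral_const_mul]

variable [IsProbabilityMeasure μ]

/-- At the critical rate the constant parts of premium and claim cancel, which leaves `θ Eτ / x` as
the leading term. -/
theorem abs_integral_increment_sub_le (hφ : IsFlow v φ) (h0 : ∀ y, 0 ≤ v y) (hC : ∀ y, v y ≤ C)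
    (hp_anti : AntitoneOn p (Set.Ioi 1)) (hrate : ∀ z, 1 < z → |v z - c - θ / z| ≤ p z)
    (hθ : 0 < θ) (hTm : Measurable T) (hT0 : ∀ᵐ ω ∂μ, 0 ≤ T ω)
    (hS2 : MemLp S 2 μ) (hT2 : MemLp T 2 μ) (hc : c * ∫ ω, T ω ∂μ = ∫ ω, S ω ∂μ)
    {x : ℝ} (hx : 1 < x) :
    |(∫ ω, increment φ S T x ω ∂μ) - θ * (∫ ω, T ω ∂μ) / x| ≤
      p x * (∫ ω, T ω ∂μ) + θ * C * (∫ ω, T ω ^ 2 ∂μ) / x ^ 2 := by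
  have hΔ := (memLp_increment hφ h0 hC hTm hT0 hS2 hT2 (by linarith : 0 ≤ x)).integrable
    one_le_two
  have hSi := hS2.integrable one_le_two
  have hTi := hT2.integrable one_le_two
  have hTsq := hT2.integrable_sq
  have e : (∫ ω, increment φ S T x ω ∂μ) - θ * (∫ ω, T ω ∂μ) / x =
      ∫ ω, (φ x (T ω) - x - (c + θ / x) * T ω) ∂μ := by
    have : ∀ ω, φ x (T ω) - x - (c + θ / x) * T ω =
        increment φ S T x ω + S ω - (c + θ / x) * T ω := fun ω => by unfold increment; ring
    simp_rw [this]
    have e1 := integral_sub (hΔ.add hSi) (hTi.const_mul (c + θ / x))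
    have e2 := integral_add hΔ hSi
    simp only [Pi.add_apply] at e1
    rw [e1, e2, integral_const_mul, ← hc]
    ring
  rw [e, ← Real.norm_eq_abs]
  refine (norm_integral_le_of_norm_le
    (g := fun ω => p x * T ω + θ * C / x ^ 2 * T ω ^ 2)
    ((hTi.const_mul _).add (hTsq.const_mul _)) ?_).trans (le_of_eq ?_)
  · filter_upwards [hT0] with ω h
    refine (hφ.abs_sub_le h0 hC hp_anti hrate hθ hx h).1.trans (le_of_eq ?_)
    ring
  · rw [integral_add (hTi.const_mul _) (hTsq.const_mul _), integral_const_mul,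
      integral_const_mul]
    ring

theorem integral_sq_centered (hS2 : MemLp S 2 μ) (hT2 : MemLp T 2 μ) (hind : IndepFun S T μ)
    (hc : c * ∫ ω, T ω ∂μ = ∫ ω, S ω ∂μ) :
    ∫ ω, (c * T ω - S ω) ^ 2 ∂μ = variance S μ + c ^ 2 * variance T μ := by
  have hcT : MemLp (fun ω => c * T ω) 2 μ := hT2.const_mul c
  have hnS : MemLp (fun ω => (-1) * S ω) 2 μ := hS2.const_mul (-1)
  have hi : IndepFun (fun ω => c * T ω) (fun ω => (-1) * S ω) μ :=
    hind.symm.comp (measurable_const_mul c) (measurable_const_mul (-1))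
  have h1 := hi.variance_add hcT hnS
  rw [variance_const_mul, variance_const_mul] at h1
  have h2 : ∫ ω, ((fun ω => c * T ω) + fun ω => (-1) * S ω) ω ∂μ = 0 := by
    simp only [Pi.add_apply]
    rw [integral_add (hcT.integrable one_le_two) (hnS.integrable one_le_two), integral_const_mul,
      integral_const_mul, hc]
    ring
  rw [variance_of_integral_eq_zero (hcT.add hnS).aemeasurable h2] at h1
  calc ∫ ω, (c * T ω - S ω) ^ 2 ∂μ
      = ∫ ω, ((fun ω => c * T ω) + fun ω => (-1) * S ω) ω ^ 2 ∂μ := by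
        congr 1; funext ω; simp only [Pi.add_apply]; ring
    _ = variance S μ + c ^ 2 * variance T μ := by
        simp only [Pi.add_apply] at h1 ⊢
        rw [h1]; ring

end Moments

/-! ### The sign of the drift of the perturbed function. -/

section Drift

open IsPerturbation

variable {v p : ℝ → ℝ} {φ : ℝ → ℝ → ℝ} {C c θ : ℝ}
variable {Ω : Type*} [MeasurableSpace Ω] {μ : Measure Ω} [IsProbabilityMeasure μ] {S T : Ω → ℝ}
variable {ρ r s x₀ : ℝ} {q : ℝ → ℝ}

theorem integrable_lyapunov_comp (hp : IsPerturbation ρ s q x₀) {Z : Ω → ℝ} (hZ : Measurable Z) :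
    Integrable (fun ω => lyapunov ρ s q x₀ (Z ω)) μ := by
  refine (integrable_const (2 / ρ)).mono'
    (hp.antitone_lyapunov.measurable.comp hZ).aestronglyMeasurable (Eventually.of_forall fun ω => ?_)
  have := hp.lyapunov_bound (Z ω)
  rw [Real.norm_of_nonneg this.1]
  exact this.2

theorem lyapunov_drift_eq (hp : IsPerturbation ρ s q x₀) {x : ℝ}
    (hm : Measurable (increment φ S T x)) (hΔ : MemLp (increment φ S T x) 2 μ) :
    Integrable (fun ω => remainder ρ s q x₀ x (increment φ S T x ω)) μ ∧
    (∫ ω, lyapunov ρ s q x₀ (φ x (T ω) - S ω) ∂μ) - lyapunov ρ s q x₀ x =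
      -(lyapunovDensity ρ s q x * ∫ ω, increment φ S T x ω ∂μ) +
        lyapunovCurvature ρ s q x * (∫ ω, increment φ S T x ω ^ 2 ∂μ) / 2 +
        ∫ ω, remainder ρ s q x₀ x (increment φ S T x ω) ∂μ := by
  have h1 := hΔ.integrable one_le_two
  have h2 := hΔ.integrable_sq
  have hF : Integrable (fun ω => lyapunov ρ s q x₀ (x + increment φ S T x ω)) μ :=
    integrable_lyapunov_comp hp (hm.const_add x)
  have hi1 := hF.sub (integrable_const (lyapunov ρ s q x₀ x))
  have hi2 := h1.const_mul (lyapunovDensity ρ s q x)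
  have hi3 := (h2.const_mul (lyapunovCurvature ρ s q x)).div_const 2
  have hi : Integrable (fun ω => remainder ρ s q x₀ x (increment φ S T x ω)) μ :=
    (hi1.add hi2).sub hi3
  refine ⟨hi, ?_⟩
  have e : ∫ ω, remainder ρ s q x₀ x (increment φ S T x ω) ∂μ =
      ((∫ ω, lyapunov ρ s q x₀ (x + increment φ S T x ω) ∂μ) - lyapunov ρ s q x₀ x) +
      lyapunovDensity ρ s q x * (∫ ω, increment φ S T x ω ∂μ) -
      lyapunovCurvature ρ s q x * (∫ ω, increment φ S T x ω ^ 2 ∂μ) / 2 := by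
    have e1 := integral_sub (hi1.add hi2) hi3
    have e2 := integral_add hi1 hi2
    have e3 := integral_sub hF (integrable_const (lyapunov ρ s q x₀ x))
    simp only [Pi.add_apply, Pi.sub_apply] at e1 e2 e3
    simp only [remainder]
    rw [e1, e2, e3, integral_const_mul, integral_div, integral_const_mul]
    simp
  rw [e]
  have : ∀ ω, x + increment φ S T x ω = φ x (T ω) - S ω := fun ω => by
    unfold increment; ring
  simp_rw [this]
  ring

/-- The increment lies between `-S` and `C * T`, so the kernel bound applies with `z = S` and `y = C
* T`. The moment of order `2 + r` goes into the constant. -/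
theorem abs_integral_remainder_le (hp : IsPerturbation ρ s q x₀) (hφ : IsFlow v φ)
    (h0 : ∀ y, 0 ≤ v y) (hC : ∀ y, v y ≤ C) (hSm : Measurable S) (hTm : Measurable T)
    (hS0 : ∀ᵐ ω ∂μ, 0 ≤ S ω) (hT0 : ∀ᵐ ω ∂μ, 0 ≤ T ω) (hT2 : MemLp T 2 μ)
    (hr : 0 < r) (hr1 : r ≤ 1) (hSr : Integrable (fun ω => S ω ^ (2 + r)) μ)
    (hSρ : Integrable (fun ω => S ω ^ (ρ + 2)) μ) (hp0 : ∀ x, 1 < x → 0 ≤ p x)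
    {x : ℝ} (hx : 2 * x₀ < x) :
    |∫ ω, remainder ρ s q x₀ x (increment φ S T x ω) ∂μ| ≤ jumpConst ρ *
      (1 + ∫ ω, S ω ^ (2 + r) ∂μ) * x ^ (-(ρ + 1)) *
        errorRate μ (fun ω => C * T ω) S p ρ r x := by
  have hC0 : 0 ≤ C := (h0 0).trans (hC 0)
  have h1 := hp.one_le
  have hρ := hp.exponent_pos
  have hx0 : 0 < x := by linarith
  have hX0 : ∀ᵐ ω ∂μ, 0 ≤ C * T ω := hT0.mono fun ω h => mul_nonneg hC0 h
  have hu : Integrable (fun ω => upKernel x (C * T ω)) μ :=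
    integrable_upKernel (hTm.const_mul C) hX0 (hT2.const_mul C).integrable_sq (by linarith)
  have hd := integrable_downKernel hSm hS0 hρ hSρ x
  have hm := hSr.const_mul (x ^ (-(1 + r)))
  have hB : 0 < x ^ (-(ρ + 1)) := Real.rpow_pos_of_pos hx0 _
  have hJ : 0 < jumpConst ρ := by
    have := curvatureConst_pos hρ
    unfold jumpConst remainderConst
    positivity
  rw [← Real.norm_eq_abs]
  refine (norm_integral_le_of_norm_le
    (g := fun ω => jumpConst ρ * x ^ (-(ρ + 1)) * (upKernel x (C * T ω) +
      x ^ (-(1 + r)) * S ω ^ (2 + r) + downKernel ρ x (S ω)))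
    (((hu.add hm).add hd).const_mul _) ?_).trans ?_
  · filter_upwards [hS0, hT0] with ω hS hT
    have h2 := hφ.sub_mem_Icc h0 hC hx0.le hT
    refine hp.abs_remainder_le_kernels hx hr hr1 (mul_nonneg hC0 hT) hS ?_ ?_
    · unfold increment; linarith [h2.2]
    · unfold increment; linarith [h2.1]
  · have e1 := integral_add (hu.add hm) hd
    have e2 := integral_add hu hm
    simp only [Pi.add_apply] at e1 e2
    rw [integral_const_mul, e1, e2, integral_const_mul]
    have hU0 : 0 ≤ ∫ ω, upKernel x (C * T ω) ∂μ := integral_nonneg_of_ae (hX0.mono fun ω h =>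
      upKernel_nonneg hx0 h)
    have hD0 : 0 ≤ ∫ ω, downKernel ρ x (S ω) ∂μ := integral_nonneg_of_ae (hS0.mono fun ω h =>
      downKernel_nonneg h)
    have hM0 : 0 ≤ ∫ ω, S ω ^ (2 + r) ∂μ := integral_nonneg_of_ae (hS0.mono fun ω h =>
      Real.rpow_nonneg h _)
    have hP := hp0 x (by linarith)
    have hxr : 0 < x ^ (-(1 + r)) := Real.rpow_pos_of_pos hx0 _
    unfold errorRate
    rw [show jumpConst ρ * (1 + ∫ ω, S ω ^ (2 + r) ∂μ) * x ^ (-(ρ + 1)) =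
      jumpConst ρ * x ^ (-(ρ + 1)) * (1 + ∫ ω, S ω ^ (2 + r) ∂μ) by ring, mul_assoc (_ * _)]
    refine mul_le_mul_of_nonneg_left ?_ (by positivity)
    have hMp := mul_nonneg hM0 hP
    have hMU := mul_nonneg hM0 hU0
    have hMD := mul_nonneg hM0 hD0
    nlinarith

/-- The place where the value of `ρ` matters: the leading parts of mean and second moment cancel,
and only errors remain. -/
theorem neg_add_moment_eq {I₁ I₂ σ m x : ℝ} (h : (ρ + 1) * σ = 2 * θ * m) (hx : x ≠ 0) :
    -I₁ + (ρ + 1) * I₂ / (2 * x) =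
      -(I₁ - θ * m / x) + (ρ + 1) / 2 * ((I₂ - σ) / x) := by
  have : θ * m / x = (ρ + 1) * σ / (2 * x) := by
    rw [h]; field_simp
  rw [this]; field_simp; ring

/-- Because `s² = 1`, multiplying by `s` makes the contribution of `q` positive for both signs. -/
theorem sign_mul_generator_eq (hs : s * s = 1) {x : ℝ} (hx : 0 < x) (I₁ I₂ : ℝ) :
    s * (-(lyapunovDensity ρ s q x * I₁) + lyapunovCurvature ρ s q x * I₂ / 2) =
      x ^ (-(ρ + 1)) * (s * (1 + s * rateTail q x) * (-I₁ + (ρ + 1) * I₂ / (2 * x)) +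
        q x * I₂ / 2) := by
  simp only [lyapunovDensity, lyapunovCurvature]
  rw [show -(ρ + 2) = -(ρ + 1) - 1 by ring, Real.rpow_sub_one hx.ne']
  have : q x * I₂ / 2 = s * s * (q x * I₂ / 2) := by rw [hs, one_mul]
  rw [this]
  field_simp
  ring

/-- The perturbation contributes at least `σ y / 4`; half of it absorbs all errors by `hA`. -/
theorem sign_generator_lower_bound {B f D y I₂ σ K J E Rm : ℝ} (hB : 0 < B) (hs : |s| = 1)
    (hf : 1 / 2 ≤ f ∧ f ≤ 3 / 2) (hD : |D| ≤ K * E) (hI : σ / 2 ≤ I₂) (hy : 0 < y)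
    (hR : |Rm| ≤ J * B * E) (hA : (3 / 2 * K + J) * E ≤ σ / 8 * y) :
    σ / 8 * (B * y) ≤ B * (s * f * D + y * I₂ / 2) + s * Rm := by
  have t1 : |s * f * D| ≤ 3 / 2 * (K * E) := by
    rw [abs_mul, abs_mul, hs, one_mul, abs_of_nonneg (by linarith [hf.1] : 0 ≤ f)]
    exact mul_le_mul hf.2 hD (abs_nonneg _) (by norm_num)
  have t2 : y * σ / 4 ≤ y * I₂ / 2 := by
    have := mul_le_mul_of_nonneg_left hI hy.le
    linarith
  have t3 : |s * Rm| ≤ J * B * E := by rw [abs_mul, hs, one_mul]; exact hR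
  have t4 := mul_le_mul_of_nonneg_left (add_le_add (abs_le.1 t1).1 t2) hB.le
  have t5 := mul_le_mul_of_nonneg_left hA hB.le
  have t6 := (abs_le.1 t3).1
  linarith

set_option maxHeartbeats 1000000 in
-- The order of choices avoids circularity: the error constants depend on `ρ` and the data but not
-- on `q`. So `q = lam * q₀` is fixed after them, and only then is `x₀` taken large enough for the
-- perturbation to be small. One `q` serves both signs.
theorem exists_perturbation_drift (hφ : IsFlow v φ) (h0 : ∀ y, 0 ≤ v y) (hC : ∀ y, v y ≤ C)
    (hp_anti : AntitoneOn p (Set.Ioi 1)) (hp_int : IntegrableAtFilter p atTop)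
    (hrate : ∀ z, 1 < z → |v z - c - θ / z| ≤ p z)
    (hθ : 0 < θ) (hSm : Measurable S) (hTm : Measurable T)
    (hS0 : ∀ᵐ ω ∂μ, 0 ≤ S ω) (hT0 : ∀ᵐ ω ∂μ, 0 ≤ T ω) (hS2 : MemLp S 2 μ) (hT2 : MemLp T 2 μ)
    (hTlog : Integrable (fun ω => T ω ^ 2 * Real.log (1 + T ω)) μ)
    (hρ : 0 < ρ) (hSρ : Integrable (fun ω => S ω ^ (ρ + 2)) μ)
    (hc : c * ∫ ω, T ω ∂μ = ∫ ω, S ω ∂μ)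
    (hσ : 0 < ∫ ω, (c * T ω - S ω) ^ 2 ∂μ)
    (hρeq : (ρ + 1) * ∫ ω, (c * T ω - S ω) ^ 2 ∂μ = 2 * θ * ∫ ω, T ω ∂μ) :
    ∃ (q : ℝ → ℝ) (x₀ x₁ : ℝ), x₀ ≤ x₁ ∧ ∀ s : ℝ, (s = 1 ∨ s = -1) →
      IsPerturbation ρ s q x₀ ∧ ∀ x, x₁ ≤ x →
        (∫ ω, (c * T ω - S ω) ^ 2 ∂μ) / 8 * (x ^ (-(ρ + 1)) * q x) ≤
          s * ((∫ ω, lyapunov ρ s q x₀ (φ x (T ω) - S ω) ∂μ) - lyapunov ρ s q x₀ x) := by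
  have hC0 : 0 ≤ C := (h0 0).trans (hC 0)
  have hp0 : ∀ x, 1 < x → 0 ≤ p x := fun x hx => (abs_nonneg _).trans (hrate x hx)
  -- `r ≤ ρ` makes the moment of order `2 + r` finite, `r ≤ 1` is needed for the interpolation of
  -- the cubic term, and `r > 0` makes `x ^ (-(1 + r))` integrable.
  set r : ℝ := min ρ 1 with hrdef
  have hr : 0 < r := lt_min hρ one_pos
  have hr1 : r ≤ 1 := min_le_right _ _
  have hSr : Integrable (fun ω => S ω ^ (2 + r)) μ := by
    refine (hSρ.add (integrable_const (1 : ℝ))).mono' (hSm.pow_const _).aestronglyMeasurable ?_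
    filter_upwards [hS0] with ω h
    rw [Real.norm_of_nonneg (by positivity)]
    change S ω ^ (2 + r) ≤ S ω ^ (ρ + 2) + 1
    rcases le_total (S ω) 1 with h1 | h1
    · have := Real.rpow_le_one h h1 (show 0 ≤ 2 + r by linarith)
      have : 0 ≤ S ω ^ (ρ + 2) := by positivity
      linarith
    · have := Real.rpow_le_rpow_of_exponent_le h1
        (show 2 + r ≤ ρ + 2 by linarith [min_le_left ρ 1])
      linarith
  have hX0 : ∀ᵐ ω ∂μ, 0 ≤ C * T ω := hT0.mono fun ω h => mul_nonneg hC0 h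
  have hX2 : Integrable (fun ω => (C * T ω) ^ 2) μ := (hT2.const_mul C).integrable_sq
  have hXlog : Integrable (fun ω => (C * T ω) ^ 2 * Real.log (1 + 2 * (C * T ω))) μ := by
    have hg := (hT2.integrable_sq.const_mul (C ^ 2 * Real.log (1 + 2 * C))).add
      (hTlog.const_mul (C ^ 2))
    refine hg.mono' (by fun_prop) ?_
    filter_upwards [hT0] with ω h
    have h2 : 0 ≤ 2 * (C * T ω) := by positivity
    rw [Real.norm_of_nonneg (mul_nonneg (sq_nonneg _) (Real.log_nonneg (by linarith)))]
    have h3 : Real.log (1 + 2 * (C * T ω)) ≤ Real.log (1 + 2 * C) + Real.log (1 + T ω) := by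
      rw [← Real.log_mul (by positivity) (by positivity)]
      exact Real.log_le_log (by linarith) (by nlinarith)
    calc _ ≤ (C * T ω) ^ 2 * (Real.log (1 + 2 * C) + Real.log (1 + T ω)) :=
          mul_le_mul_of_nonneg_left h3 (sq_nonneg _)
      _ = C ^ 2 * Real.log (1 + 2 * C) * T ω ^ 2 + C ^ 2 * (T ω ^ 2 * Real.log (1 + T ω)) := by
          ring
  obtain ⟨q₀, hq₀, hle⟩ := exists_isSlowRate_errorRate (hTm.const_mul C) hSm hX0 hS0 hX2 hXlog hρ
    hSρ hr hp_anti hp_int hp0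
  set E : ℝ → ℝ := errorRate μ (fun ω => C * T ω) S p ρ r with hE
  set m := ∫ ω, T ω ∂μ with hm
  set m₂ := ∫ ω, T ω ^ 2 ∂μ with hm₂
  set w := ∫ ω, |c * T ω - S ω| * T ω ∂μ with hw
  set σ := ∫ ω, (c * T ω - S ω) ^ 2 ∂μ with hσdef
  set M := 1 + ∫ ω, S ω ^ (2 + r) ∂μ with hM
  have hm0 : 0 ≤ m := integral_nonneg_of_ae hT0
  have hm₂0 : 0 ≤ m₂ := integral_nonneg fun ω => sq_nonneg _
  have hw0 : 0 ≤ w := integral_nonneg_of_ae (hT0.mono fun ω h => mul_nonneg (abs_nonneg _) h)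
  have hM0 : 0 ≤ M := add_nonneg zero_le_one
    (integral_nonneg_of_ae (hS0.mono fun ω h => Real.rpow_nonneg h _))
  have hJ : 0 < jumpConst ρ := by
    have := curvatureConst_pos hρ
    unfold jumpConst remainderConst
    positivity
  have hEp : ∀ x, 1 < x → p x + 1 / x ^ 2 ≤ E x := by
    intro x hx
    have hx0 : 0 < x := by linarith
    have h2 : 0 ≤ ∫ ω, upKernel x (C * T ω) ∂μ := integral_nonneg_of_ae (hX0.mono fun ω h =>
      upKernel_nonneg hx0 h)
    have h3 : 0 ≤ ∫ ω, downKernel ρ x (S ω) ∂μ := integral_nonneg_of_ae (hS0.mono fun ω h =>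
      downKernel_nonneg h)
    have h4 : 1 / x ^ 2 ≤ x ^ (-(1 + r)) := by
      rw [one_div, ← Real.rpow_two, ← Real.rpow_neg hx0.le]
      exact Real.rpow_le_rpow_of_exponent_le hx.le (by linarith)
    rw [hE]; unfold errorRate
    linarith
  set N := p 2 + θ with hN
  have hN0 : 0 ≤ N := add_nonneg (hp0 2 (by norm_num)) hθ.le
  set η : ℝ → ℝ := fun x => p x + θ / x with hη
  have hηN : ∀ x, 2 ≤ x → 0 ≤ η x ∧ η x ≤ N := by
    intro x hx
    have h1 : (1 : ℝ) < x := by linarith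
    refine ⟨add_nonneg (hp0 x h1) (by positivity), add_le_add ?_ ?_⟩
    · exact hp_anti (show (1 : ℝ) < 2 by norm_num) h1 hx
    · exact div_le_self hθ.le h1.le
  set L := 2 * w + N * m₂ with hL
  have hL0 : 0 ≤ L := by positivity
  have hm1 : ∀ x, 2 ≤ x → |(∫ ω, increment φ S T x ω ∂μ) - θ * m / x| ≤
      (m + θ * C * m₂) * E x := by
    intro x hx
    have h1 : (1 : ℝ) < x := by linarith
    refine (abs_integral_increment_sub_le hφ h0 hC hp_anti hrate hθ hTm hT0 hS2 hT2 hc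
      h1).trans ?_
    have h2 := hEp x h1
    have h3 := hp0 x h1
    have h4 : 0 ≤ 1 / x ^ 2 := by positivity
    have h5 : 0 ≤ θ * C * m₂ := by positivity
    rw [div_eq_mul_one_div (θ * C * m₂)]
    nlinarith
  have hm2 : ∀ x, 2 ≤ x → |(∫ ω, increment φ S T x ω ^ 2 ∂μ) - σ| ≤ L * η x := by
    intro x hx
    obtain ⟨h1, h2⟩ := hηN x hx
    refine (abs_integral_increment_sq_sub_le hφ h0 hC hp_anti hrate hθ hTm hT0 hS2 hT2
      (by linarith)).trans ?_
    change 2 * η x * w + η x ^ 2 * m₂ ≤ L * η x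
    have : η x ^ 2 ≤ N * η x := by nlinarith
    have := mul_le_mul_of_nonneg_right this hm₂0
    rw [hL]; linarith
  have hηE : ∀ x, 2 ≤ x → η x / x ≤ (1 + θ) * E x := by
    intro x hx
    have hx0 : 0 < x := by linarith
    have h2 := hEp x (by linarith)
    have h3 := hp0 x (by linarith)
    have h4 : p x / x ≤ p x := div_le_self h3 (by linarith)
    have h5 : 0 ≤ 1 / x ^ 2 := by positivity
    have e : η x / x = p x / x + θ * (1 / x ^ 2) := by
      simp only [hη]; field_simp
    rw [e]
    nlinarith
  set K := (m + θ * C * m₂) + (ρ + 1) / 2 * (L * (1 + θ)) with hK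
  have hK0 : 0 ≤ K := by positivity
  set A := 3 / 2 * K + jumpConst ρ * M with hA
  have hA0 : 0 ≤ A := by positivity
  -- Chosen so that `σ / 8 * lam ≥ A`; the added `1` keeps it positive and at least `1`.
  set lam := 8 / σ * A + 1 with hlam
  have hlam0 : 0 < lam := by positivity
  have hq := hq₀.const_mul hlam0
  have hxq := tendsto_mul_of_antitoneOn_integrableOn hq.anti hq.integrable
    fun x hx => (hq.pos x hx).le
  have htail := tendsto_integral_Ioi_atTop_zero hq.integrable
  have hηlim : Tendsto (fun x => L * η x) atTop (𝓝 0) := by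
    have hx1 : Tendsto (fun x => L * (x * (lam * q₀ x) + θ / x)) atTop (𝓝 0) := by
      simpa using (hxq.add (tendsto_const_nhds.div_atTop tendsto_id)).const_mul L
    refine squeeze_zero' ?_ ?_ hx1
    · filter_upwards [eventually_ge_atTop 2] with x hx
      exact mul_nonneg hL0 (hηN x hx).1
    · filter_upwards [eventually_ge_atTop 2] with x hx
      refine mul_le_mul_of_nonneg_left (add_le_add ?_ le_rfl) hL0
      have h1 := hle x hx
      have h2 := hEp x (by linarith)
      have h3 : 0 ≤ 1 / x ^ 2 := by positivity
      have h4 := hq₀.pos x (by linarith)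
      have h5 : 1 ≤ lam := by rw [hlam]; linarith [show 0 ≤ 8 / σ * A by positivity]
      have h6 : q₀ x ≤ lam * q₀ x := le_mul_of_one_le_left h4.le h5
      have h7 : lam * q₀ x ≤ x * (lam * q₀ x) :=
        le_mul_of_one_le_left (by positivity) (by linarith)
      linarith
  obtain ⟨a, ha⟩ := ((htail.eventually_le_const (show (0 : ℝ) < 1 / 2 by norm_num)).and
    (hxq.eventually_le_const one_pos)).exists_forall_of_atTop
  obtain ⟨b, hb⟩ := (hηlim.eventually_le_const (show 0 < σ / 2 by positivity)).exists_forall_of_atTop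
  -- Beyond `x₁` one has `x > 2 * x₀`, as the Taylor estimate requires, and by `b` the second moment
  -- is at least `σ / 2`.
  refine ⟨fun x => lam * q₀ x, max a 1, max (2 * max a 1 + 1) b, ?_, fun s hs => ?_⟩
  · refine le_trans ?_ (le_max_left _ _)
    linarith [le_max_right a 1]
  have hpert : IsPerturbation ρ s (fun x => lam * q₀ x) (max a 1) :=
    { exponent_pos := hρ
      abs_sign := by rcases hs with rfl | rfl <;> simp
      one_le := le_max_right _ _
      slow := hq
      tail_le := fun x hx => (ha x ((le_max_left _ _).trans hx)).1
      mul_le := fun x hx => (ha x ((le_max_left _ _).trans hx)).2 }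
  refine ⟨hpert, fun x hx => ?_⟩
  have hss : s * s = 1 := by rcases hs with rfl | rfl <;> norm_num
  have hsabs : |s| = 1 := by rcases hs with rfl | rfl <;> simp
  have hx2 : 2 * max a 1 < x := by linarith [(le_max_left (2 * max a 1 + 1) b).trans hx]
  have hxge : 2 ≤ x := by linarith [le_max_right a 1]
  have hx0 : 0 < x := by linarith
  have hxx₀ : max a 1 ≤ x := by linarith [le_max_right a 1]
  have hmeas := measurable_increment hφ.measurable hSm hTm x
  have hΔ := memLp_increment hφ h0 hC hTm hT0 hS2 hT2 hx0.le
  obtain ⟨-, hdrift⟩ := lyapunov_drift_eq hpert hmeas hΔ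
  have hrem := abs_integral_remainder_le hpert hφ h0 hC hSm hTm hS0 hT0 hT2 hr hr1 hSr hSρ hp0 hx2
  have hf := hpert.factor_mem hxx₀
  have h1 := hm1 x hxge
  have h2 := hm2 x hxge
  have h3 := hηE x hxge
  have h4 := hb x ((le_max_right _ _).trans hx)
  have hB : 0 < x ^ (-(ρ + 1)) := Real.rpow_pos_of_pos hx0 _
  have hqE : E x ≤ q₀ x := hle x hxge
  have hE0 : 0 ≤ E x := by
    have := hEp x (by linarith)
    have := hp0 x (by linarith)
    have : 0 ≤ 1 / x ^ 2 := by positivity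
    linarith
  set I₁ := ∫ ω, increment φ S T x ω ∂μ with hI₁
  set I₂ := ∫ ω, increment φ S T x ω ^ 2 ∂μ with hI₂
  set Rm := ∫ ω, remainder ρ s (fun x => lam * q₀ x) (max a 1) x (increment φ S T x ω) ∂μ
    with hRm
  set f := 1 + s * rateTail (fun x => lam * q₀ x) x with hfdef
  set B := x ^ (-(ρ + 1)) with hBdef
  have hD : |-I₁ + (ρ + 1) * I₂ / (2 * x)| ≤ K * E x := by
    have e : -I₁ + (ρ + 1) * I₂ / (2 * x) =
        -(I₁ - θ * m / x) + (ρ + 1) / 2 * ((I₂ - σ) / x) :=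
      neg_add_moment_eq hρeq hx0.ne'
    rw [e]
    refine (abs_add_le _ _).trans ?_
    rw [abs_neg, abs_mul, abs_div (I₂ - σ), abs_of_pos hx0,
      abs_of_pos (show 0 < (ρ + 1) / 2 by positivity)]
    have h5 : |I₂ - σ| / x ≤ L * ((1 + θ) * E x) := by
      calc |I₂ - σ| / x ≤ L * η x / x := div_le_div_of_nonneg_right h2 hx0.le
        _ = L * (η x / x) := by ring
        _ ≤ _ := mul_le_mul_of_nonneg_left h3 hL0
    have h6 := mul_le_mul_of_nonneg_left h5 (show 0 ≤ (ρ + 1) / 2 by linarith)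
    rw [hK]; linarith
  have hmain : s * (-(lyapunovDensity ρ s (fun x => lam * q₀ x) x * I₁) +
      lyapunovCurvature ρ s (fun x => lam * q₀ x) x * I₂ / 2) =
      B * (s * f * (-I₁ + (ρ + 1) * I₂ / (2 * x)) + lam * q₀ x * I₂ / 2) :=
    sign_mul_generator_eq hss hx0 I₁ I₂
  rw [hdrift, mul_add, hmain]
  have hI₂σ : σ / 2 ≤ I₂ := by
    have := (abs_le.1 h2).1
    clear_value σ I₂ η L
    linarith only [this, h4]
  have hlq : 0 < lam * q₀ x := hq.pos x hx0
  have t4 : A * E x ≤ σ / 8 * (lam * q₀ x) := by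
    have h5 : A ≤ σ / 8 * lam := by
      rw [hlam]
      have : σ / 8 * (8 / σ * A + 1) = A + σ / 8 := by field_simp
      rw [this]; linarith
    calc A * E x ≤ A * q₀ x := mul_le_mul_of_nonneg_left hqE hA0
      _ ≤ σ / 8 * lam * q₀ x := mul_le_mul_of_nonneg_right h5 (hq₀.pos x hx0).le
      _ = _ := by ring
  exact sign_generator_lower_bound hB hsabs hf hD hI₂σ hlq hrem t4

end Drift

/-! ### Comparison of the ruin probability with the Lyapunov functions. -/

section Final

variable {Ω : Type*} [MeasurableSpace Ω] {μ : Measure Ω}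
variable {φ : ℝ → ℝ → ℝ} {S T : Ω → ℝ}

theorem transition_map_eq (hφ : Measurable (Function.uncurry φ)) (hS : Measurable S)
    (hT : Measurable T) {f : ℝ → ENNReal} (hf : Measurable f) {y : ℝ} (hy : 0 ≤ y) :
    transition φ (μ.map fun ω => (T ω, S ω)) f y = ∫⁻ ω, f (φ y (T ω) - S ω) ∂μ := by
  have hm : Measurable fun z => f (reserveStep φ y z) :=
    hf.comp ((measurable_reserveStep hφ).comp (measurable_const.prodMk measurable_id))
  rw [transition, lintegral_map hm (hT.prodMk hS)]
  simp [reserveStep, not_lt.2 hy]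

theorem measurable_flow_sub (hφ : Measurable (Function.uncurry φ)) (hS : Measurable S)
    (hT : Measurable T) (y : ℝ) : Measurable fun ω => φ y (T ω) - S ω :=
  (hφ.comp (measurable_const.prodMk hT)).sub hS

variable [IsProbabilityMeasure μ]

/-- Suppose the supremum `W` of `w` is positive. Far out `w ≤ W / 2` by decay of `F`; on the
remaining levels above `x₁` the drift forces `w ≤ W - γ` with a uniform gap, as `γ` decreases. Both
contradict the supremum, which need not be attained. -/
theorem nonpos_of_subharmonic {w F γ : ℝ → ℝ} {Z : ℝ → Ω → ℝ} {x₁ : ℝ}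
    (hwF : ∀ y, w y ≤ F y) (hF0 : Tendsto F atTop (𝓝 0)) (hFb : BddAbove (Set.range w))
    (hneg : ∀ y, y < x₁ → w y ≤ 0) (hγ : ∀ y, x₁ ≤ y → 0 < γ y) (hγa : AntitoneOn γ (Set.Ici x₁))
    (hint : ∀ y, x₁ ≤ y → Integrable (fun ω => w (Z y ω)) μ)
    (hsub : ∀ y, x₁ ≤ y → w y ≤ (∫ ω, w (Z y ω) ∂μ) - γ y) (y : ℝ) : w y ≤ 0 := by
  by_contra! hy
  set W := sSup (Set.range w) with hW
  have hle : ∀ z, w z ≤ W := fun z => le_csSup hFb ⟨z, rfl⟩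
  have hW0 : 0 < W := hy.trans_le (hle y)
  obtain ⟨b, hb⟩ := (hF0.eventually_le_const (show 0 < W / 2 by linarith)).exists_forall_of_atTop
  have hγ0 := hγ (max b x₁) (le_max_right _ _)
  have hall : ∀ z, w z ≤ max (W / 2) (W - γ (max b x₁)) := by
    intro z
    rcases lt_or_ge z x₁ with h | h
    · exact (hneg z h).trans (le_max_of_le_left (by linarith))
    rcases le_or_gt b z with hbz | hbz
    · exact (hwF z).trans ((hb z hbz).trans (le_max_left _ _))
    · refine le_max_of_le_right ((hsub z h).trans ?_)
      have h1 : ∫ ω, w (Z z ω) ∂μ ≤ ∫ _, W ∂μ :=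
        integral_mono (hint z h) (integrable_const _) fun ω => hle _
      have h2 : γ (max b x₁) ≤ γ z := hγa h (le_max_right b x₁) (hbz.le.trans (le_max_left _ _))
      simp at h1
      linarith
  have : W ≤ max (W / 2) (W - γ (max b x₁)) := csSup_le (Set.range_nonempty w) (by
    rintro _ ⟨z, rfl⟩; exact hall z)
  rcases le_max_iff.1 this with h | h <;> linarith

theorem chainRuin_toReal_eq_integral (hφ : Measurable (Function.uncurry φ)) (hS : Measurable S)
    (hT : Measurable T) {y : ℝ} (hy : 0 ≤ y) :
    (chainRuin φ (μ.map fun ω => (T ω, S ω)) y).toReal =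
      ∫ ω, (chainRuin φ (μ.map fun ω => (T ω, S ω)) (φ y (T ω) - S ω)).toReal ∂μ := by
  have : IsProbabilityMeasure (μ.map fun ω => (T ω, S ω)) :=
    Measure.isProbabilityMeasure_map (hT.prodMk hS).aemeasurable
  rw [← transition_chainRuin hφ, transition_map_eq hφ hS hT (measurable_chainRuin hφ) hy,
    integral_toReal]
  · exact ((measurable_chainRuin hφ).comp (measurable_flow_sub hφ hS hT y)).aemeasurable
  · exact Eventually.of_forall fun ω => (chainRuin_le_one _).trans_lt ENNReal.one_lt_top

theorem chainRuin_toReal_le {F : ℝ → ℝ} {x₁ : ℝ} (hφ : Measurable (Function.uncurry φ))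
    (hS : Measurable S) (hT : Measurable T) (hx₁ : 0 ≤ x₁) (hF : Measurable F)
    (hF0 : ∀ y, 0 ≤ F y) (h1 : ∀ y < x₁, 1 ≤ F y)
    (hint : ∀ y, x₁ ≤ y → Integrable (fun ω => F (φ y (T ω) - S ω)) μ)
    (h2 : ∀ y, x₁ ≤ y → ∫ ω, F (φ y (T ω) - S ω) ∂μ ≤ F y) (y : ℝ) :
    (chainRuin φ (μ.map fun ω => (T ω, S ω)) y).toReal ≤ F y := by
  have : IsProbabilityMeasure (μ.map fun ω => (T ω, S ω)) :=
    Measure.isProbabilityMeasure_map (hT.prodMk hS).aemeasurable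
  refine ENNReal.toReal_le_of_le_ofReal (hF0 y) ?_
  refine chainRuin_le (F := fun y => ENNReal.ofReal (F y)) hx₁ (fun y hy => ?_) (fun y hy => ?_) y
  · simpa using h1 y hy
  · rw [transition_map_eq hφ hS hT hF.ennreal_ofReal (hx₁.trans hy),
      ← ofReal_integral_eq_lintegral_ofReal (hint y hy) (Eventually.of_forall fun ω => hF0 _)]
    exact ENNReal.ofReal_le_ofReal (h2 y hy)

theorem chainRuin_bounds_of_drift {ρ x₀ x₁ κ : ℝ} {q : ℝ → ℝ}
    (hφ : Measurable (Function.uncurry φ)) (hS : Measurable S) (hT : Measurable T)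
    (hx : x₀ ≤ x₁) (hκ : 0 < κ)
    (hpert : ∀ s : ℝ, (s = 1 ∨ s = -1) → IsPerturbation ρ s q x₀ ∧ ∀ x, x₁ ≤ x →
      κ * (x ^ (-(ρ + 1)) * q x) ≤
        s * ((∫ ω, lyapunov ρ s q x₀ (φ x (T ω) - S ω) ∂μ) - lyapunov ρ s q x₀ x))
    (hψ : ∃ ε : ℝ, 0 < ε ∧ ∀ x : ℝ, 0 ≤ x → x ≤ x₁ →
      ε ≤ (chainRuin φ (μ.map fun ω => (T ω, S ω)) x).toReal) :
    ∃ c₁ c₂ : ℝ, 0 < c₁ ∧ 0 < c₂ ∧ ∀ x : ℝ, 0 < x →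
      c₁ / (1 + x) ^ ρ ≤ (chainRuin φ (μ.map fun ω => (T ω, S ω)) x).toReal ∧
      (chainRuin φ (μ.map fun ω => (T ω, S ω)) x).toReal ≤ c₂ / (1 + x) ^ ρ := by
  have : IsProbabilityMeasure (μ.map fun ω => (T ω, S ω)) :=
    Measure.isProbabilityMeasure_map (hT.prodMk hS).aemeasurable
  set ψ : ℝ → ℝ := fun x => (chainRuin φ (μ.map fun ω => (T ω, S ω)) x).toReal with hψdef
  have hψm : Measurable ψ := (measurable_chainRuin hφ).ennreal_toReal
  have hψ0 : ∀ x, 0 ≤ ψ x := fun x => ENNReal.toReal_nonneg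
  have hψ1 : ∀ x, ψ x ≤ 1 := fun x =>
    ENNReal.toReal_le_of_le_ofReal zero_le_one (by simpa using chainRuin_le_one x)
  obtain ⟨hp, hdp⟩ := hpert 1 (Or.inl rfl)
  obtain ⟨hn, hdn⟩ := hpert (-1) (Or.inr rfl)
  have hρ := hp.exponent_pos
  have hx₁1 : 1 ≤ x₁ := hp.one_le.trans hx
  have hx₁0 : 0 < x₁ := by linarith
  set Fp := lyapunov ρ 1 q x₀ with hFp
  set Fn := lyapunov ρ (-1) q x₀ with hFn
  have hg : ∀ y, x₁ ≤ y → 0 < κ * (y ^ (-(ρ + 1)) * q y) := by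
    intro y hy
    have hy0 : 0 < y := hx₁0.trans_le hy
    have := Real.rpow_pos_of_pos hy0 (-(ρ + 1))
    have := hp.slow.pos y hy0
    positivity
  have hintp : ∀ y, Integrable (fun ω => Fp (φ y (T ω) - S ω)) μ := fun y =>
    integrable_lyapunov_comp hp (measurable_flow_sub hφ hS hT y)
  have hintn : ∀ y, Integrable (fun ω => Fn (φ y (T ω) - S ω)) μ := fun y =>
    integrable_lyapunov_comp hn (measurable_flow_sub hφ hS hT y)
  have hintψ : ∀ y, Integrable (fun ω => ψ (φ y (T ω) - S ω)) μ := fun y =>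
    (integrable_const (1 : ℝ)).mono'
      (hψm.comp (measurable_flow_sub hφ hS hT y)).aestronglyMeasurable
      (Eventually.of_forall fun ω => by rw [Real.norm_of_nonneg (hψ0 _)]; exact hψ1 _)
  -- upper bound
  set δ := Fn x₁ with hδ
  have hδ0 : 0 < δ := by
    have := (hn.lyapunov_mem hx).1
    have h2 := Real.rpow_pos_of_pos hx₁0 (-ρ)
    exact lt_of_lt_of_le (by positivity) this
  have hupper : ∀ y, ψ y ≤ Fn y / δ := by
    refine chainRuin_toReal_le hφ hS hT hx₁0.le (hn.antitone_lyapunov.measurable.div_const δ)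
      (fun y => div_nonneg (hn.lyapunov_bound y).1 hδ0.le) (fun y hy => ?_)
      (fun y _ => (hintn y).div_const δ) (fun y hy => ?_)
    · rw [le_div_iff₀ hδ0, one_mul]
      exact hn.antitone_lyapunov hy.le
    · rw [integral_div]
      refine div_le_div_of_nonneg_right ?_ hδ0.le
      have h1 := hdn y hy
      have h2 := hg y hy
      linarith
  -- lower bound
  obtain ⟨ε, hε, hψε⟩ := hψ
  set ε' := min ε 1 with hε'
  have hε'0 : 0 < ε' := lt_min hε one_pos
  have hψε' : ∀ y, y ≤ x₁ → ε' ≤ ψ y := by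
    intro y hy
    rcases lt_or_ge y 0 with h | h
    · simp only [hψdef, chainRuin_of_neg h, ENNReal.toReal_one]
      exact min_le_right _ _
    · exact (min_le_left _ _).trans (hψε y h hy)
  -- With this constant `D * ψ ≥ 2 / ρ ≥ Fp` up to `x₁`; at negative levels `ψ = 1`, which is why
  -- `ε'` is capped at `1`.
  set D := 2 / ρ / ε' with hD
  have hD0 : 0 < D := by positivity
  have hlower : ∀ y, Fp y ≤ D * ψ y := by
    intro y
    -- Since `ψ` is harmonic and `Fp` subharmonic, `-η * Fn` supplies the strict gap `γ`; afterwards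
    -- `η → 0`.
    have hη : ∀ η : ℝ, 0 < η → Fp y ≤ D * ψ y + η * Fn y := by
      intro η hη
      have h := nonpos_of_subharmonic (μ := μ) (w := fun z => Fp z - D * ψ z - η * Fn z) (F := Fp)
        (γ := fun z => η * (κ * (z ^ (-(ρ + 1)) * q z))) (Z := fun z ω => φ z (T ω) - S ω)
        (x₁ := x₁) ?_ ?_ ?_ ?_ ?_ ?_ ?_ ?_ y
      · linarith
      · intro z
        have h1 := mul_nonneg hD0.le (hψ0 z)
        have h2 := mul_nonneg hη.le (hn.lyapunov_bound z).1
        linarith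
      · have h1 : Tendsto (fun z : ℝ => 3 / 2 * (z ^ (-ρ) / ρ)) atTop (𝓝 0) := by
          simpa using ((tendsto_rpow_neg_atTop hρ).div_const ρ).const_mul (3 / 2)
        refine squeeze_zero' (Eventually.of_forall fun z => (hp.lyapunov_bound z).1) ?_ h1
        filter_upwards [eventually_ge_atTop x₀] with z hz
        exact (hp.lyapunov_mem hz).2
      · refine ⟨2 / ρ, ?_⟩
        rintro _ ⟨z, rfl⟩
        have h1 := mul_nonneg hD0.le (hψ0 z)
        have h2 := mul_nonneg hη.le (hn.lyapunov_bound z).1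
        have h3 := (hp.lyapunov_bound z).2
        simp only
        linarith
      · intro z hz
        have h1 := mul_le_mul_of_nonneg_left (hψε' z hz.le) hD0.le
        have h2 := mul_nonneg hη.le (hn.lyapunov_bound z).1
        have h3 := (hp.lyapunov_bound z).2
        have h4 : D * ε' = 2 / ρ := by rw [hD]; field_simp
        linarith
      · intro z hz
        exact mul_pos hη (hg z hz)
      · intro a ha b hb hab
        have ha0 : 0 < a := hx₁0.trans_le ha
        have hb0 : 0 < b := hx₁0.trans_le hb
        refine mul_le_mul_of_nonneg_left (mul_le_mul_of_nonneg_left ?_ hκ.le) hη.le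
        exact mul_le_mul (Real.rpow_le_rpow_of_nonpos ha0 hab (by linarith))
          (hp.slow.anti ha0 hb0 hab) (hp.slow.pos b hb0).le (Real.rpow_nonneg ha0.le _)
      · intro z _
        exact ((hintp z).sub ((hintψ z).const_mul D)).sub ((hintn z).const_mul η)
      · intro z hz
        have e1 := integral_sub ((hintp z).sub ((hintψ z).const_mul D)) ((hintn z).const_mul η)
        have e2 := integral_sub (hintp z) ((hintψ z).const_mul D)
        simp only [Pi.sub_apply] at e1 e2
        rw [e1, e2, integral_const_mul, integral_const_mul]
        have h1 := hdp z hz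
        have h2 := mul_le_mul_of_nonneg_left (hdn z hz) hη.le
        have h3 := hg z hz
        have h4 : ψ z = ∫ ω, ψ (φ z (T ω) - S ω) ∂μ :=
          chainRuin_toReal_eq_integral hφ hS hT (hx₁0.le.trans hz)
        rw [← h4]
        linarith
    have hlim : Tendsto (fun η : ℝ => D * ψ y + η * Fn y) (𝓝[>] 0) (𝓝 (D * ψ y)) := by
      have : Continuous fun η : ℝ => D * ψ y + η * Fn y := by fun_prop
      have h := this.tendsto 0
      simp only [zero_mul, add_zero] at h
      exact h.mono_left nhdsWithin_le_nhds
    exact ge_of_tendsto hlim (eventually_mem_nhdsWithin.mono fun η h => hη η h)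
  -- Each constant combines the trivial bound for `x ≤ x₁` with the one from the Lyapunov functions
  -- for `x > x₁`; the factor `2 ^ ρ` comes from `1 + x ≤ 2 * x`.
  refine ⟨min ε' (1 / (2 * ρ * D)), (1 + x₁) ^ ρ + 3 / 2 / ρ / δ * 2 ^ ρ,
    lt_min hε'0 (by positivity), by positivity, fun x hx0 => ?_⟩
  have h1x : 0 < 1 + x := by linarith
  have hpow : 0 < (1 + x) ^ ρ := Real.rpow_pos_of_pos h1x _
  rcases le_or_gt x x₁ with hle | hgt
  · constructor
    · refine le_trans ?_ (hψε' x hle)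
      have : 1 ≤ (1 + x) ^ ρ := Real.one_le_rpow (by linarith) hρ.le
      exact (div_le_self (le_of_lt (lt_min hε'0 (by positivity))) this).trans (min_le_left _ _)
    · refine (hψ1 x).trans ?_
      rw [le_div_iff₀ hpow, one_mul]
      have h1 : (1 + x) ^ ρ ≤ (1 + x₁) ^ ρ := Real.rpow_le_rpow h1x.le (by linarith) hρ.le
      have : 0 < 3 / 2 / ρ / δ * (2 : ℝ) ^ ρ := by positivity
      linarith
  · have hxx₀ : x₀ ≤ x := hx.trans hgt.le
    constructor
    · have h1 := (hp.lyapunov_mem hxx₀).1.trans (hlower x)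
      have h2 : 1 / (1 + x) ^ ρ ≤ x ^ (-ρ) := by
        rw [Real.rpow_neg hx0.le, one_div]
        exact inv_anti₀ (Real.rpow_pos_of_pos hx0 _)
          (Real.rpow_le_rpow hx0.le (by linarith) hρ.le)
      calc min ε' (1 / (2 * ρ * D)) / (1 + x) ^ ρ ≤ 1 / (2 * ρ * D) / (1 + x) ^ ρ :=
            div_le_div_of_nonneg_right (min_le_right _ _) hpow.le
        _ = 1 / (2 * ρ * D) * (1 / (1 + x) ^ ρ) := by ring
        _ ≤ 1 / (2 * ρ * D) * x ^ (-ρ) := mul_le_mul_of_nonneg_left h2 (by positivity)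
        _ = x ^ (-ρ) / ρ / 2 / D := by field_simp
        _ ≤ D * ψ x / D := div_le_div_of_nonneg_right h1 hD0.le
        _ = ψ x := by field_simp
    · have h2 : x ^ (-ρ) ≤ 2 ^ ρ / (1 + x) ^ ρ := by
        rw [Real.rpow_neg hx0.le, ← Real.div_rpow (by norm_num) h1x.le,
          ← Real.inv_rpow hx0.le]
        refine Real.rpow_le_rpow (by positivity) ?_ hρ.le
        rw [inv_eq_one_div, div_le_div_iff₀ hx0 h1x]
        linarith
      calc ψ x ≤ Fn x / δ := hupper x
        _ ≤ 3 / 2 * (x ^ (-ρ) / ρ) / δ :=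
            div_le_div_of_nonneg_right (hn.lyapunov_mem hxx₀).2 hδ0.le
        _ = 3 / 2 / ρ / δ * x ^ (-ρ) := by ring
        _ ≤ 3 / 2 / ρ / δ * (2 ^ ρ / (1 + x) ^ ρ) := mul_le_mul_of_nonneg_left h2 (by positivity)
        _ = 3 / 2 / ρ / δ * 2 ^ ρ / (1 + x) ^ ρ := by ring
        _ ≤ _ := div_le_div_of_nonneg_right
            (le_add_of_nonneg_left (by positivity)) hpow.le

/-- Excludes zero limit variance. As `x p(x) → 0`, eventually `p z ≤ θ / z` and so `v z ≥ c`. When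
each claim equals `c` times its waiting time, the premium covers every claim, and `[x₁, ∞)` is never
left. Its complement's indicator is then a superharmonic majorant. -/
theorem exists_chainRuin_eq_zero {v p : ℝ → ℝ} {C c θ : ℝ} (hφ : IsFlow v φ)
    (h0 : ∀ y, 0 ≤ v y) (hC : ∀ y, v y ≤ C)
    (hp_anti : AntitoneOn p (Set.Ioi 1)) (hp_int : IntegrableAtFilter p atTop)
    (hrate : ∀ z, 1 < z → |v z - c - θ / z| ≤ p z) (hθ : 0 < θ)
    (hS : Measurable S) (hT : Measurable T) (hT0 : ∀ᵐ ω ∂μ, 0 ≤ T ω)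
    (hW : ∀ᵐ ω ∂μ, c * T ω - S ω = 0) :
    ∃ x, 0 ≤ x ∧ (chainRuin φ (μ.map fun ω => (T ω, S ω)) x).toReal = 0 := by
  obtain ⟨s, hs, hse⟩ := hp_int
  obtain ⟨a, ha⟩ := mem_atTop_sets.1 hs
  have hsub : Set.Ioi (max a 1) ⊆ Set.Ioi 1 := Set.Ioi_subset_Ioi (le_max_right _ _)
  have hlim := tendsto_mul_of_antitoneOn_integrableOn (hp_anti.mono hsub)
    (hse.mono_set fun x hx => ha x ((le_max_left a 1).trans (le_of_lt hx)))
    (fun x hx => (abs_nonneg _).trans (hrate x (hsub hx)))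
  obtain ⟨b, hb⟩ := (hlim.eventually_le_const hθ).exists_forall_of_atTop
  set x₁ := max b 2 with hx₁
  have hx₁2 : 2 ≤ x₁ := le_max_right _ _
  have hv : ∀ z, x₁ ≤ z → c ≤ v z := by
    intro z hz
    have hz0 : 0 < z := by linarith
    have h1 := (abs_le.1 (hrate z (by linarith))).1
    have h2 : p z ≤ θ / z := by
      rw [le_div_iff₀ hz0, mul_comm]
      exact hb z ((le_max_left _ _).trans hz)
    linarith
  have hstep : ∀ y, x₁ ≤ y → ∀ᵐ ω ∂μ, x₁ ≤ φ y (T ω) - S ω := by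
    intro y hy
    have hy0 : 0 ≤ y := by linarith
    filter_upwards [hT0, hW] with ω hTω hWω
    obtain ⟨hint, heq⟩ := hφ.path y hy0 (T ω) hTω
    have h1 : ∫ _ in (0 : ℝ)..T ω, c ≤ ∫ u in (0 : ℝ)..T ω, v (φ y u) := by
      refine intervalIntegral.integral_mono_on hTω intervalIntegrable_const hint fun u hu => ?_
      have := (hφ.sub_mem_Icc h0 hC hy0 hu.1).1
      exact hv _ (by linarith)
    simp only [intervalIntegral.integral_const, smul_eq_mul, sub_zero] at h1
    rw [heq]
    linarith
  have hF1 : ∀ y, (Set.Iio x₁).indicator (1 : ℝ → ℝ) y ≤ 1 := fun y =>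
    Set.indicator_le_self' (fun _ _ => zero_le_one) y
  have hzero : ∀ y, x₁ ≤ y →
      (fun ω => (Set.Iio x₁).indicator (1 : ℝ → ℝ) (φ y (T ω) - S ω)) =ᵐ[μ] 0 := by
    intro y hy
    filter_upwards [hstep y hy] with ω h
    simp [Set.indicator, not_lt.2 h]
  refine ⟨x₁, by linarith, le_antisymm ?_ ENNReal.toReal_nonneg⟩
  have := chainRuin_toReal_le (μ := μ) (F := (Set.Iio x₁).indicator 1) hφ.measurable hS hT
    (by linarith : 0 ≤ x₁) (measurable_one.indicator measurableSet_Iio)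
    (fun y => Set.indicator_nonneg (fun _ _ => zero_le_one) y)
    (fun y hy => by simp [hy])
    (fun y hy => (integrable_zero Ω ℝ μ).congr (hzero y hy).symm)
    (fun y hy => by
      rw [integral_congr_ae (hzero y hy)]
      simp [not_lt.2 hy]) x₁
  simpa using this

end Final

end RiskModel

/-! ### Assembly under the stated hypotheses. -/

theorem mainTheorem3 {Ω : Type*} [MeasurableSpace Ω] (μ : Measure Ω) [IsProbabilityMeasure μ]
    (ξ τ : ℕ → Ω → ℝ)
    (hξ_meas : ∀ n, Measurable (ξ n)) (hτ_meas : ∀ n, Measurable (τ n))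
    (hξ_nonneg : ∀ n, ∀ᵐ ω ∂μ, 0 ≤ ξ n ω) (hτ_nonneg : ∀ n, ∀ᵐ ω ∂μ, 0 ≤ τ n ω)
    (hξ_ident : ∀ n, IdentDistrib (ξ n) (ξ 0) μ μ)
    (hτ_ident : ∀ n, IdentDistrib (τ n) (τ 0) μ μ)
    (hξ_indep : iIndepFun ξ μ) (hτ_indep : iIndepFun τ μ)
    (hξτ_indep : IndepFun (fun ω n => ξ n ω) (fun ω n => τ n ω) μ)
    (hτ_pos : 0 < ∫ ω, τ 0 ω ∂μ)
    (hξ_var : MemLp (ξ 0) 2 μ)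
    (v : ℝ → ℝ) (hv_meas : Measurable v) (hv_nonneg : ∀ y, 0 ≤ v y)
    (hv_bdd : ∃ C : ℝ, ∀ y, v y ≤ C) (hv_flow : RiskModel.HasUniqueFlow v)
    (R : ℝ → ℝ → Ω → ℝ) (hR : RiskModel.IsRiskProcess μ v ξ τ R)
    (hψ : ∀ x₀ : ℝ, ∃ ε : ℝ, 0 < ε ∧
      ∀ x : ℝ, 0 ≤ x → x ≤ x₀ → ε ≤ RiskModel.ruinProb μ R x)
    (θ : ℝ) (p : ℝ → ℝ)
    (hp_anti : AntitoneOn p (Set.Ioi 1)) (hp_int : IntegrableAtFilter p atTop volume)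
    (hv_rate : ∀ z : ℝ, 1 < z →
      |v z - RiskModel.criticalRate μ (ξ 0) (τ 0) - θ / z| ≤ p z)
    (hθ : RiskModel.limitVariance μ (ξ 0) (τ 0) / (2 * ∫ ω, τ 0 ω ∂μ) < θ)
    (hτ_log : Integrable (fun ω => τ 0 ω ^ 2 * Real.log (1 + τ 0 ω)) μ)
    (hξ_moment : Integrable
      (fun ω => ξ 0 ω ^ (RiskModel.decayExponent μ (ξ 0) (τ 0) θ + 2)) μ) :
    ∃ c₁ c₂ : ℝ, 0 < c₁ ∧ 0 < c₂ ∧ ∀ x : ℝ, 0 < x →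
      c₁ / (1 + x) ^ RiskModel.decayExponent μ (ξ 0) (τ 0) θ ≤ RiskModel.ruinProb μ R x ∧
      RiskModel.ruinProb μ R x ≤ c₂ / (1 + x) ^ RiskModel.decayExponent μ (ξ 0) (τ 0) θ := by
  open RiskModel in
  obtain ⟨C, hC⟩ := hv_bdd
  obtain ⟨φ, hφ⟩ := exists_isFlow hv_nonneg hC hv_flow
  have hruin : ∀ x, 0 ≤ x → ruinProb μ R x =
      (chainRuin φ (μ.map fun ω => (τ 0 ω, ξ 0 ω)) x).toReal := fun x hx =>
    ruinProb_eq_chainRuin hξ_meas hτ_meas hξ_nonneg hτ_nonneg hξ_ident hτ_ident hξ_indep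
      hτ_indep hξτ_indep hτ_pos hv_nonneg hv_flow hφ hR hx
  have hind : IndepFun (ξ 0) (τ 0) μ :=
    hξτ_indep.comp (measurable_pi_apply 0) (measurable_pi_apply 0)
  -- The logarithmic moment dominates the square: `log (1 + t) ≥ 1` for `t ≥ 2` because `e < 3`, and
  -- `t² ≤ 4` otherwise.
  have hT2 : MemLp (τ 0) 2 μ := by
    rw [memLp_two_iff_integrable_sq (hτ_meas 0).aestronglyMeasurable]
    refine (hτ_log.add (integrable_const (4 : ℝ))).mono'
      ((hτ_meas 0).pow_const 2).aestronglyMeasurable ?_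
    filter_upwards [hτ_nonneg 0] with ω h
    rw [Real.norm_of_nonneg (sq_nonneg _)]
    change τ 0 ω ^ 2 ≤ τ 0 ω ^ 2 * Real.log (1 + τ 0 ω) + 4
    have hlog : 0 ≤ Real.log (1 + τ 0 ω) := Real.log_nonneg (by linarith)
    rcases le_total (τ 0 ω) 2 with h2 | h2
    · have : 0 ≤ τ 0 ω ^ 2 * Real.log (1 + τ 0 ω) := by positivity
      nlinarith
    · have : 1 ≤ Real.log (1 + τ 0 ω) := by
        rw [Real.le_log_iff_exp_le (by linarith)]
        linarith [Real.exp_one_lt_d9]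
      nlinarith [sq_nonneg (τ 0 ω)]
  set c := criticalRate μ (ξ 0) (τ 0) with hcdef
  have hc : c * ∫ ω, τ 0 ω ∂μ = ∫ ω, ξ 0 ω ∂μ := by
    rw [hcdef, criticalRate]; field_simp
  have hσ : ∫ ω, (c * τ 0 ω - ξ 0 ω) ^ 2 ∂μ = limitVariance μ (ξ 0) (τ 0) :=
    integral_sq_centered hξ_var hT2 hind hc
  have hσ0 : 0 ≤ limitVariance μ (ξ 0) (τ 0) := hσ ▸ integral_nonneg fun ω => sq_nonneg _
  have hθ0 : 0 < θ := lt_of_le_of_lt (by positivity) hθ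
  -- Zero variance would give `c τ = ξ` almost surely and a level with no ruin, against condition 1.
  have hσpos : 0 < limitVariance μ (ξ 0) (τ 0) := by
    refine lt_of_le_of_ne hσ0 fun h => ?_
    have hW : ∀ᵐ ω ∂μ, c * τ 0 ω - ξ 0 ω = 0 := by
      have hi : Integrable (fun ω => (c * τ 0 ω - ξ 0 ω) ^ 2) μ :=
        ((hT2.const_mul c).sub hξ_var).integrable_sq
      rw [← h, integral_eq_zero_iff_of_nonneg (fun ω => sq_nonneg _) hi] at hσ
      filter_upwards [hσ] with ω hω
      exact pow_eq_zero_iff two_ne_zero |>.1 hω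
    obtain ⟨x, hx, hzero⟩ := exists_chainRuin_eq_zero hφ hv_nonneg hC hp_anti hp_int hv_rate hθ0
      (hξ_meas 0) (hτ_meas 0) (hτ_nonneg 0) hW
    obtain ⟨ε, hε, hle⟩ := hψ x
    have := hle x hx le_rfl
    rw [hruin x hx, hzero] at this
    linarith
  set ρ := decayExponent μ (ξ 0) (τ 0) θ with hρdef
  have hρeq : (ρ + 1) * limitVariance μ (ξ 0) (τ 0) = 2 * θ * ∫ ω, τ 0 ω ∂μ := by
    rw [hρdef, decayExponent]; field_simp; ring
  -- Condition 3 says that `2 θ Eτ` exceeds the limit variance, that is `ρ + 1 > 1`.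
  have hρ : 0 < ρ := by
    rw [div_lt_iff₀ (by positivity)] at hθ
    by_contra! hneg
    have : (ρ + 1) * limitVariance μ (ξ 0) (τ 0) ≤ 1 * limitVariance μ (ξ 0) (τ 0) :=
      mul_le_mul_of_nonneg_right (by linarith) hσ0
    linarith
  obtain ⟨q, x₀, x₁, hx, hpert⟩ := exists_perturbation_drift hφ hv_nonneg hC hp_anti hp_int hv_rate
    hθ0 (hξ_meas 0) (hτ_meas 0) (hξ_nonneg 0) (hτ_nonneg 0) hξ_var hT2 hτ_log hρ hξ_moment hc
    (hσ ▸ hσpos) (hσ ▸ hρeq)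
  obtain ⟨ε, hε, hle⟩ := hψ x₁
  obtain ⟨c₁, c₂, h1, h2, h3⟩ := chainRuin_bounds_of_drift hφ.measurable (hξ_meas 0) (hτ_meas 0) hx
    (show 0 < (∫ ω, (c * τ 0 ω - ξ 0 ω) ^ 2 ∂μ) / 8 by rw [hσ]; positivity) hpert
    ⟨ε, hε, fun x hx0 hx1 => hruin x hx0 ▸ hle x hx0 hx1⟩
  refine ⟨c₁, c₂, h1, h2, fun x hx0 => ?_⟩
  rw [hruin x hx0.le]
  exact h3 x hx0
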